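/- **Setting.** Let $N\ge 2$, let $U\subseteq\mathbb R^d$ be open, let $f^{\{1\}},\dots,f^{\{N\}}$ be vector fields that are $C^\infty$ on $U$, and for $v\subseteq\{1,\dots,N\}$ put $f^{\{v\}}=\sum_{m\in v}f^{\{m\}}$, $f=f^{\{r\}}$ with $r=\{1,\dots,N\}$. Write $\varphi^{\{v\}}_t$ for the (local) exact $t$-flow of $x'=f^{\{v\}}(x)$ in $U$ and $D_Y=\langle Y,\nabla\rangle$ for the Lie derivative along a vector field $Y$. A *splitting tree* is a full ordered binary tree $G$ with node set $V$ consisting of non-empty subsets of $\{1,\dots,N\}$, with root $r$, such that the left and right child of each inner node form a disjoint decomposition of it and each leaf is a singleton. Let $I$ be the set of inner nodes and $L$ the set of leaves. For $v\in V$ let $\mathcal P^{\{v\}}\subseteq I$ be the set of nodes on the path from $r$ to $v$ without $v$, and $\bar{\mathcal P}^{\{v\}}=\mathcal P^{\{v\}}\cup\{v\}$. For $w\in\mathcal P^{\{v\}}$ let $\delta^{\{v\}}(w)=1$ if the left child of $w$ lies in $\bar{\mathcal P}^{\{v\}}$, and $\delta^{\{v\}}(w)=0$ if the right child does. A *multirate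 hierarchical splitting method* consists of a splitting tree; a multirate factor $M^{\{v\}}\in\{1,2,\dots\}$ for each $v\in V\setminus\{r\}$; a number of stages $s^{\{i\}}$ and real coefficients $a^{\{i\}}_j,b^{\{i\}}_j$ $(1\le j\le s^{\{i\}})$ for each $i\in I$; a set $L'\subseteq L$ and a one-step scheme $\Phi^{\{\ell\}}_h$ for each $\ell\in L'$; for $\ell\in L\setminus L'$ one has $M^{\{\ell\}}=1$. For $i\in I$ with left child $v$ and right child $w$ put $$\Phi^{\{i\}}_h=\varphi^{\{w\}}_{b^{\{i\}}_{s}h}\circ\varphi^{\{v\}}_{a^{\{i\}}_{s}h}\circ\dots\circ\varphi^{\{w\}}_{b^{\{i\}}_1h}\circ\varphi^{\{v\}}_{a^{\{i\}}_1h},\qquad s=s^{\{i\}}.$$ The sub-step $\mathrm{Step}(v,c,h)$, which advances node $v$ by $c\,h$, is defined recursively. Let $\tilde M=1$ if $v=r$ and $\tilde M=\lceil|c|M^{\{v\}}\rceil$ otherwise. If $v\in I$ has left child $v_1$ and right child $v_2$, then $\mathrm{Step}(v,c,h)$ is the $\tilde M$-fold iterate of $$\mathrm{Step}(v_2,b^{\{v\}}_{s}c/\tilde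 M,h)\circ\mathrm{Step}(v_1,a^{\{v\}}_{s}c/\tilde M,h)\circ\dots\circ\mathrm{Step}(v_2,b^{\{v\}}_1c/\tilde M,h)\circ\mathrm{Step}(v_1,a^{\{v\}}_1c/\tilde M,h),\quad s=s^{\{v\}};$$ if $v\in L'$, it is the $\tilde M$-fold iterate of $\Phi^{\{v\}}_{ch/\tilde M}$; if $v\in L\setminus L'$, it is $\varphi^{\{v\}}_{ch}$. (For $\tilde M=0$, i.e. $c=0$, the iterate is the identity.) The overall method is $\Phi_h=\mathrm{Step}(r,1,h)$. For $v\in V$ let $\mathcal J^{\{v\}}$ be the set of tuples $(j_w)_{w\in\mathcal P^{\{v\}}}$ with $1\le j_w\le s^{\{w\}}$, and for such a tuple define, recursively along the path, $$A^{\{v\}}_{(j_w)}=\prod_{w\in\mathcal P^{\{v\}}}\Big(\delta^{\{v\}}(w)a^{\{w\}}_{j_w}+(1-\delta^{\{v\}}(w))b^{\{w\}}_{j_w}\Big),\quad c^{\{v\}}_{(j_w)}=\frac{A^{\{v\}}_{(j_w)}}{\prod_{u\in\mathcal P^{\{v\}}\setminus\{r\}}M^{\{u\}}_{(j_w)}},\quad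 M^{\{v\}}_{(j_w)}=\Big\lceil|c^{\{v\}}_{(j_w)}|\,M^{\{v\}}\Big\rceil ,$$ where quotients with numerator $0$ are read as $0$, and $M^{\{u\}}_{(j_w)}$ uses the restriction of the tuple to $\mathcal P^{\{u\}}$. **Meaning of the exponential form.** Fix $K\in\{0,1,2,\dots\}\cup\{\infty\}$. For a one-step method $\Psi_h$, a vector field $g$, $q\ge1$ and a vector field $\mathcal O$ on $U$ we write $$\Psi_h=\exp\!\big(hD_g+h^{q+1}\mathcal O+\mathcal O(h^{q+2})\big)\mathrm{Id}$$ if there is a formal series $Y(h)=\sum_{k\ge1}h^kY_k$ of vector fields that are $C^\infty$ on $U$, with $Y_1=g$, $Y_k=0$ for $2\le k\le q$ and $Y_{q+1}=\mathcal O$, such that $\Psi_h(x)$ has, as $h\to0$ (with either sign) and locally uniformly in $x\in U$, the asymptotic expansion $\exp(D_{Y(h)})\mathrm{Id}(x)=\sum_{n\ge0}\frac1{n!}D_{Y(h)}^n\mathrm{Id}(x)$ up to and including the power $h^{q+1+K}$ (that is, up to an $O(h^{q+2})$ if $K=0$, and to all orders if $K=\infty$). **Theorem.** Suppose that for each $v\in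 I\cup L'$ there are an integer $p^{\{v\}}\ge1$ and a vector field $\mathcal O^{\{v\}}_{p^{\{v\}}+1}$ with $$\Phi^{\{v\}}_h=\exp\!\Big(hD_{f^{\{v\}}}+h^{p^{\{v\}}+1}\mathcal O^{\{v\}}_{p^{\{v\}}+1}+\mathcal O(h^{p^{\{v\}}+2})\Big)\mathrm{Id},$$ and let $p=\min_{v\in I\cup L'}p^{\{v\}}$. Then $$\Phi_h=\exp\!\big(hD_f+h^{p+1}\mathcal O_{p+1}+\mathcal O(h^{p+2})\big)\mathrm{Id}$$ (with the same $K$), where $$\mathcal O_{p+1}=\sum_{\substack{v\in I\cup L'\\ p^{\{v\}}=p}}\left[\sum_{(j_w)\in\mathcal J^{\{v\}}}\frac{\big(A^{\{v\}}_{(j_w)}\big)^{p+1}}{\Big(\prod_{w\in\bar{\mathcal P}^{\{v\}}\setminus\{r\}}M^{\{w\}}_{(j_u)}\Big)^{p}}\right]\mathcal O^{\{v\}}_{p+1}$$ (summands with numerator $0$ are $0$). Moreover $\Phi_h$ is convergent of order at least $p$: for every solution $\gamma:[0,T]\to U$ of $x'=f(x)$ there are $C,h_0>0$ such that $\|\Phi_h^{n}(\gamma(0))-\gamma(nh)\|\le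 C\,h^{p}$ for all $0<h\le h_0$ and all $n\in\mathbb{N}$ (with $0\in\mathbb N$) with $nh\le T$. -/

import Mathlib

open scoped ContDiff Topology

/-- The `t`-flow of `x' = f(x)` on the open set `U`: the value at time `t` of the solution with
initial value `x` that stays in `U` (and `x` itself when no solution exists up to time `t`). -/
noncomputable def exactFlow {d : ℕ} (U : Set (EuclideanSpace ℝ (Fin d)))
    (f : EuclideanSpace ℝ (Fin d) → EuclideanSpace ℝ (Fin d)) (t : ℝ)
    (x : EuclideanSpace ℝ (Fin d)) : EuclideanSpace ℝ (Fin d) :=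
  open Classical in
  if H : ∃ γ : ℝ → EuclideanSpace ℝ (Fin d), γ 0 = x ∧
      ∀ τ ∈ Set.uIcc 0 t, γ τ ∈ U ∧ HasDerivWithinAt γ (f (γ τ)) (Set.uIcc 0 t) τ
  then H.choose t else x

/-- The Lie derivative `⟨Y, ∇⟩ g` of a (vector valued) function `g` along the vector field `Y`. -/
noncomputable def lieDeriv {d : ℕ} (Y g : EuclideanSpace ℝ (Fin d) → EuclideanSpace ℝ (Fin d)) :
    EuclideanSpace ℝ (Fin d) → EuclideanSpace ℝ (Fin d) :=
  fun x => fderiv ℝ g x (Y x)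

/-- For the formal operator `D(h) = ∑ k, h ^ k ⟨Y k, ∇⟩`, the coefficient of `h ^ m` in
`D(h) ^ r Id`. -/
noncomputable def powCoeff {d : ℕ}
    (Y : ℕ → EuclideanSpace ℝ (Fin d) → EuclideanSpace ℝ (Fin d)) :
    ℕ → ℕ → EuclideanSpace ℝ (Fin d) → EuclideanSpace ℝ (Fin d)
  | 0, m => if m = 0 then id else 0
  | r + 1, m => ∑ i ∈ Finset.HasAntidiagonal.antidiagonal m, lieDeriv (Y i.1) (powCoeff Y r i.2)

/-- For `D(h) = ∑ k, h ^ k ⟨Y k, ∇⟩` with `Y 0 = 0`, the coefficient of `h ^ m` in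
`exp(D(h)) Id = ∑ r, D(h) ^ r Id / r!`; the terms with `m < r` do not contribute as `Y 0 = 0`. -/
noncomputable def expCoeff {d : ℕ}
    (Y : ℕ → EuclideanSpace ℝ (Fin d) → EuclideanSpace ℝ (Fin d)) (m : ℕ) :
    EuclideanSpace ℝ (Fin d) → EuclideanSpace ℝ (Fin d) :=
  ∑ r ∈ Finset.range (m + 1), ((r.factorial : ℝ)⁻¹) • powCoeff Y r m

/-- `Φ_h = exp(h ⟨f, ∇⟩ + h ^ (p + 1) ⟨e, ∇⟩ + O(h ^ (p + 2))) Id` on `U` as `h → 0`: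
there is a formal vector field `∑ k, h ^ k Y k` with smooth coefficients which equals
`h f + h ^ (p + 1) e` up to terms of order `h ^ (p + 2)`, and whose formal exponential, applied to
the identity, is the asymptotic expansion of `Φ_h`, locally uniformly on `U`.
The expansion is required up to and including the power `h ^ (p + 1 + K)`:
with `K = 0` only up to an `O(h ^ (p + 2))`, with `K = ⊤` to all orders. -/
def HasExpForm {d : ℕ} (U : Set (EuclideanSpace ℝ (Fin d))) (K : ℕ∞)
    (Φ : ℝ → EuclideanSpace ℝ (Fin d) → EuclideanSpace ℝ (Fin d))
    (f : EuclideanSpace ℝ (Fin d) → EuclideanSpace ℝ (Fin d)) (p : ℕ)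
    (e : EuclideanSpace ℝ (Fin d) → EuclideanSpace ℝ (Fin d)) : Prop :=
  ∃ Y : ℕ → EuclideanSpace ℝ (Fin d) → EuclideanSpace ℝ (Fin d),
    (∀ k, ContDiffOn ℝ ∞ (Y k) U) ∧
    Set.EqOn (Y 0) 0 U ∧
    Set.EqOn (Y 1) f U ∧
    (∀ k, 2 ≤ k → k ≤ p → Set.EqOn (Y k) 0 U) ∧
    Set.EqOn (Y (p + 1)) e U ∧
    ∀ n : ℕ, (n : ℕ∞) ≤ (p : ℕ∞) + 1 + K → ∀ x ∈ U,
      (fun q : ℝ × EuclideanSpace ℝ (Fin d) =>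
          Φ q.1 q.2 - ∑ m ∈ Finset.range (n + 1), q.1 ^ m • expCoeff Y m q.2)
        =O[𝓝 ((0 : ℝ), x)] fun q => q.1 ^ (n + 1)

/-- A splitting tree for `N` partitions: a full ordered binary tree whose nodes are non-empty
subsets of the index set, whose root is the whole index set, in which the two children of an inner
node form a disjoint decomposition of it, and whose leaves are singletons. Consequently the inner
nodes are those with at least two elements. The values of `left` and `right` at other sets are
irrelevant. -/
structure SplittingTree (N : ℕ) where
  nodes : Finset (Finset (Fin N))
  left : Finset (Fin N) → Finset (Fin N)
  right : Finset (Fin N) → Finset (Fin N)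
  root_mem : Finset.univ ∈ nodes
  nonempty : ∀ v ∈ nodes, v.Nonempty
  left_mem : ∀ v ∈ nodes, 1 < v.card → left v ∈ nodes
  right_mem : ∀ v ∈ nodes, 1 < v.card → right v ∈ nodes
  disjoint_children : ∀ v ∈ nodes, 1 < v.card → Disjoint (left v) (right v)
  union_children : ∀ v ∈ nodes, 1 < v.card → left v ∪ right v = v
  exists_parent : ∀ v ∈ nodes, v ≠ Finset.univ →
    ∃ w ∈ nodes, 1 < w.card ∧ (v = left w ∨ v = right w)

namespace SplittingTree

variable {N : ℕ} (G : SplittingTree N)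

def innerNodes : Finset (Finset (Fin N)) := G.nodes.filter fun v => 1 < v.card

def leaves : Finset (Finset (Fin N)) := G.nodes.filter fun v => v.card = 1

/-- The inner nodes on the path from the root to `v`, excluding `v`: the ancestors of `v`. As
children decompose their parent disjointly, these are the nodes that strictly contain `v`. -/
def path (v : Finset (Fin N)) : Finset (Finset (Fin N)) := G.nodes.filter fun w => v ⊂ w

/-- The path from the root to `v`, including `v`. -/
def pathBar (v : Finset (Fin N)) : Finset (Finset (Fin N)) := insert v (G.path v)

theorem left_card_lt {v : Finset (Fin N)} (hv : v ∈ G.innerNodes) :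
    (G.left v).card < v.card := by
  obtain ⟨h1, h2⟩ := Finset.mem_filter.1 hv
  have h := Finset.card_union_of_disjoint (G.disjoint_children v h1 h2)
  rw [G.union_children v h1 h2] at h
  have := (G.nonempty _ (G.right_mem v h1 h2)).card_pos
  omega

theorem right_card_lt {v : Finset (Fin N)} (hv : v ∈ G.innerNodes) :
    (G.right v).card < v.card := by
  obtain ⟨h1, h2⟩ := Finset.mem_filter.1 hv
  have h := Finset.card_union_of_disjoint (G.disjoint_children v h1 h2)
  rw [G.union_children v h1 h2] at h
  have := (G.nonempty _ (G.left_mem v h1 h2)).card_pos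
  omega

end SplittingTree

/-- The composition `B n ∘ A n ∘ ⋯ ∘ B 1 ∘ A 1`. -/
def altComp {X : Type*} (A B : ℕ → X → X) : ℕ → X → X
  | 0 => id
  | n + 1 => B (n + 1) ∘ A (n + 1) ∘ altComp A B n

/-- A multirate hierarchical splitting method for `N`-split systems in dimension `d`.
An inner node `v` carries the two-split method with `s v` stages and coefficients
`a v j`, `b v j` for `1 ≤ j ≤ s v`; `M v` is the multirate factor on the edge from `v` to its
parent; `approx` is the set of leaves that carry a numerical scheme `Ψ v`, and the remaining
leaves carry their exact flow. -/
structure MultirateHSM (d N : ℕ) extends SplittingTree N where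
  M : Finset (Fin N) → ℕ
  s : Finset (Fin N) → ℕ
  a : Finset (Fin N) → ℕ → ℝ
  b : Finset (Fin N) → ℕ → ℝ
  approx : Finset (Finset (Fin N))
  Ψ : Finset (Fin N) → ℝ → EuclideanSpace ℝ (Fin d) → EuclideanSpace ℝ (Fin d)
  M_pos : ∀ v ∈ nodes, v ≠ Finset.univ → 0 < M v
  approx_subset : approx ⊆ toSplittingTree.leaves
  M_exact : ∀ v ∈ toSplittingTree.leaves, v ∉ approx → M v = 1

namespace MultirateHSM

variable {d N : ℕ} (S : MultirateHSM d N)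

/-- The nodes that carry a numerical scheme: the inner nodes and the leaves in `approx`. -/
def active : Finset (Finset (Fin N)) := S.innerNodes ∪ S.approx

/-- The right-hand side `∑ m ∈ v, f m` of the subsystem that belongs to `v`. -/
def rhs (f : Fin N → EuclideanSpace ℝ (Fin d) → EuclideanSpace ℝ (Fin d))
    (v : Finset (Fin N)) : EuclideanSpace ℝ (Fin d) → EuclideanSpace ℝ (Fin d) :=
  fun x => ∑ m ∈ v, f m x

/-- The numerical scheme assigned to a node of `active`: at an inner node the two-split method with
the exact flows of the two children, at a leaf in `approx` the scheme `Ψ`. -/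
noncomputable def nodeMethod (U : Set (EuclideanSpace ℝ (Fin d)))
    (f : Fin N → EuclideanSpace ℝ (Fin d) → EuclideanSpace ℝ (Fin d))
    (v : Finset (Fin N)) (h : ℝ) : EuclideanSpace ℝ (Fin d) → EuclideanSpace ℝ (Fin d) :=
  if v ∈ S.innerNodes then
    altComp (fun j => exactFlow U (rhs f (S.left v)) (S.a v j * h))
      (fun j => exactFlow U (rhs f (S.right v)) (S.b v j * h)) (S.s v)
  else S.Ψ v h

/-- The number of equal sub-steps in which node `v` is advanced by `c * h`. -/
noncomputable def subSteps (v : Finset (Fin N)) (c : ℝ) : ℕ :=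
  if v = Finset.univ then 1 else ⌈|c| * (S.M v : ℝ)⌉₊

/-- The method at node `v`, advancing the state by a step of size `c * h`; exact flows are
applied without sub-stepping. -/
noncomputable def step (U : Set (EuclideanSpace ℝ (Fin d)))
    (f : Fin N → EuclideanSpace ℝ (Fin d) → EuclideanSpace ℝ (Fin d))
    (v : Finset (Fin N)) (c h : ℝ) : EuclideanSpace ℝ (Fin d) → EuclideanSpace ℝ (Fin d) :=
  if hv : v ∈ S.innerNodes then
    (altComp (fun j => step U f (S.left v) (S.a v j * c / S.subSteps v c) h)
      (fun j => step U f (S.right v) (S.b v j * c / S.subSteps v c) h) (S.s v))^[S.subSteps v c]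
  else if v ∈ S.approx then
    (S.Ψ v (c * h / S.subSteps v c))^[S.subSteps v c]
  else exactFlow U (rhs f v) (c * h)
termination_by v.card
decreasing_by
  · exact S.left_card_lt hv
  · exact S.right_card_lt hv

/-- One full time step `Φ_h` of the multirate hierarchical splitting method. -/
noncomputable def method (U : Set (EuclideanSpace ℝ (Fin d)))
    (f : Fin N → EuclideanSpace ℝ (Fin d) → EuclideanSpace ℝ (Fin d)) (h : ℝ) :
    EuclideanSpace ℝ (Fin d) → EuclideanSpace ℝ (Fin d) :=
  S.step U f Finset.univ 1 h

/-- `δ(w) a_i + (1 - δ(w)) b_i` at the node `w`, where `δ(w)` is `1` or `0` according as the path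
from the root to `v` passes from `w` to its left or to its right child. -/
noncomputable def pathCoeff (v w : Finset (Fin N)) (i : ℕ) : ℝ :=
  if S.left w ∈ S.pathBar v then S.a w i else S.b w i

/-- The product of the coefficients along the path to `v` selected by the indices `j`. -/
noncomputable def coeffProd (v : Finset (Fin N)) (j : Finset (Fin N) → ℕ) : ℝ :=
  ∏ w ∈ S.path v, S.pathCoeff v w (j w)

/-- The reweighted multirate factor of `v` at the occurrence of `v` given by the indices `j`
(of which only the values on the path to `v` matter), see `mrFactor_eq`. -/
noncomputable def mrFactor (j : Finset (Fin N) → ℕ) (v : Finset (Fin N)) : ℕ :=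
  ⌈|S.coeffProd v j / ∏ u ∈ ((S.path v).erase Finset.univ).attach, (mrFactor j u.1 : ℝ)|
    * (S.M v : ℝ)⌉₊
termination_by N - v.card
decreasing_by
  have h1 := Finset.card_lt_card (Finset.mem_filter.1 (Finset.mem_of_mem_erase u.2)).2
  have h2 := Finset.card_le_univ u.1
  rw [Fintype.card_fin] at h2
  omega

/-- The number `c` such that the occurrence of `v` given by `j` advances by `c * h`. -/
noncomputable def stepCoeff (j : Finset (Fin N) → ℕ) (v : Finset (Fin N)) : ℝ :=
  S.coeffProd v j / ∏ u ∈ (S.path v).erase Finset.univ, (S.mrFactor j u : ℝ)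

theorem mrFactor_eq (j : Finset (Fin N) → ℕ) (v : Finset (Fin N)) :
    S.mrFactor j v = ⌈|S.stepCoeff j v| * (S.M v : ℝ)⌉₊ := by
  rw [mrFactor, stepCoeff,
    Finset.prod_attach ((S.path v).erase Finset.univ) fun u => (S.mrFactor j u : ℝ)]

/-- The index tuples `(j_w)` with `1 ≤ j_w ≤ s w`, for `w` on the path to `v` (excluding `v`),
extended by `0` to all other sets. -/
def indexTuples (v : Finset (Fin N)) : Finset (Finset (Fin N) → ℕ) :=
  Fintype.piFinset fun w => if w ∈ S.path v then Finset.Icc 1 (S.s w) else {0}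

/-- The leading error term for the orders `ord v` and the leading error terms `err v` of the
schemes at the nodes. A summand whose numerator is `0` is `0`, also when its denominator
vanishes. -/
noncomputable def leadingError (ord : Finset (Fin N) → ℕ)
    (err : Finset (Fin N) → EuclideanSpace ℝ (Fin d) → EuclideanSpace ℝ (Fin d)) (p : ℕ) :
    EuclideanSpace ℝ (Fin d) → EuclideanSpace ℝ (Fin d) :=
  fun x => ∑ v ∈ S.active with ord v = p,
    (∑ j ∈ S.indexTuples v,
      (S.coeffProd v j) ^ (p + 1) /
        (∏ w ∈ (S.pathBar v).erase Finset.univ, (S.mrFactor j w : ℝ)) ^ p) • err v x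

end MultirateHSM

/-- The one-step method `Φ` converges with order `p` for `x' = f(x)` on `U`: along every exact
solution on a compact time interval the global error is `O(h ^ p)`. -/
def ConvergesWithOrder {d : ℕ} (U : Set (EuclideanSpace ℝ (Fin d)))
    (Φ : ℝ → EuclideanSpace ℝ (Fin d) → EuclideanSpace ℝ (Fin d))
    (f : EuclideanSpace ℝ (Fin d) → EuclideanSpace ℝ (Fin d)) (p : ℕ) : Prop :=
  ∀ (T : ℝ) (γ : ℝ → EuclideanSpace ℝ (Fin d)),
    (∀ t ∈ Set.Icc 0 T, γ t ∈ U ∧ HasDerivWithinAt γ (f (γ t)) (Set.Icc 0 T) t) →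
    ∃ C > 0, ∃ h₀ > 0, ∀ h : ℝ, 0 < h → h ≤ h₀ → ∀ n : ℕ, n * h ≤ T →
      ‖(Φ h)^[n] (γ 0) - γ (n * h)‖ ≤ C * h ^ p

open Filter Asymptotics

/-! No Baker–Campbell–Hausdorff calculus is needed, because every scheme is compared with the exact
flow. For order `p ≥ 1`, an exponential form amounts to two facts: `HasDefect`, saying that the
scheme minus the flow is `h ^ (p + 1) e + O(h ^ (p + 2))`, and `HasSmoothApprox`, saying that the
scheme is expandable in `h` with smooth coefficients up to the required order.
`HasExpForm.hasDefect`, `HasExpForm.hasSmoothApprox` and `hasExpForm_of_hasDefect` translate between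
the two; the way back rebuilds the formal field from the expansion by a formal logarithm.

Leading defects obey simple rules: replacing `h` by `c * h` multiplies them by `c ^ (p + 1)`, and
since all maps are `Id + O(h)`, composition adds them (`HasDefect.comp`). At an inner node,
replacing the children's steps by exact flows costs the sum of the children's errors. Replacing the
resulting two-split scheme by the flow of the node costs the node's own error, and the iterated flow
is the flow over the whole step. This gives `hasDefect_step` with the recursively defined error
`accError`.

The rest is combinatorial. Containment of nodes reproduces the tree, so the closed formulas for
`stepCoeff` and for the products of multirate factors satisfy the recursion of `step`, and
`sum_accError` unrolls the error into a sum over index tuples. Convergence follows from the local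
error, a one-step stability estimate uniform near the compact trajectory, and a discrete Gronwall
argument. -/

/-- `γ` solves `x' = f(x)` in `U` between the times `0` and `t`. -/
def IsFlowCurve {d : ℕ} (U : Set (EuclideanSpace ℝ (Fin d)))
    (f : EuclideanSpace ℝ (Fin d) → EuclideanSpace ℝ (Fin d))
    (γ : ℝ → EuclideanSpace ℝ (Fin d)) (t : ℝ) : Prop :=
  ∀ τ ∈ Set.uIcc 0 t, γ τ ∈ U ∧ HasDerivWithinAt γ (f (γ τ)) (Set.uIcc 0 t) τ

/-! ### Exact flows: uniqueness, local regularity, group law -/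

section Flow

variable {d : ℕ} {U : Set (EuclideanSpace ℝ (Fin d))}
  {f : EuclideanSpace ℝ (Fin d) → EuclideanSpace ℝ (Fin d)}

theorem IsFlowCurve.continuousOn {γ : ℝ → EuclideanSpace ℝ (Fin d)} {t : ℝ}
    (h : IsFlowCurve U f γ t) : ContinuousOn γ (Set.uIcc 0 t) :=
  fun τ hτ => (h τ hτ).2.continuousWithinAt

theorem ContDiffOn.exists_lipschitzOnWith_of_isCompact (hU : IsOpen U)
    (hf : ContDiffOn ℝ ∞ f U) {s : Set (EuclideanSpace ℝ (Fin d))} (hs : IsCompact s)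
    (hsU : s ⊆ U) : ∃ K, LipschitzOnWith K f s := by
  refine LocallyLipschitzOn.exists_lipschitzOnWith_of_compact hs fun x hx => ?_
  have hx' : ContDiffAt ℝ 1 f x :=
    ((hf x (hsU hx)).contDiffAt (hU.mem_nhds (hsU hx))).of_le (by norm_cast)
  obtain ⟨K, t, ht, h⟩ := hx'.exists_lipschitzOnWith
  exact ⟨K, t, mem_nhdsWithin_of_mem_nhds ht, h⟩

/-- The field is only locally Lipschitz on `U`, but it is Lipschitz on the compact union of the two
traces, and Gronwall uniqueness applies there, forward or backward in time. -/
theorem IsFlowCurve.eqOn (hU : IsOpen U) (hf : ContDiffOn ℝ ∞ f U)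
    {γ₁ γ₂ : ℝ → EuclideanSpace ℝ (Fin d)} {t : ℝ}
    (h₁ : IsFlowCurve U f γ₁ t) (h₂ : IsFlowCurve U f γ₂ t) (h0 : γ₁ 0 = γ₂ 0) :
    Set.EqOn γ₁ γ₂ (Set.uIcc 0 t) := by
  have c₁ := h₁.continuousOn
  have c₂ := h₂.continuousOn
  obtain ⟨K, hK⟩ := ContDiffOn.exists_lipschitzOnWith_of_isCompact hU hf
    ((isCompact_uIcc.image_of_continuousOn c₁).union (isCompact_uIcc.image_of_continuousOn c₂))
    (Set.union_subset (Set.image_subset_iff.2 fun τ hτ => (h₁ τ hτ).1)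
      (Set.image_subset_iff.2 fun τ hτ => (h₂ τ hτ).1))
  have m₁ : ∀ τ ∈ Set.uIcc 0 t, γ₁ τ ∈ γ₁ '' Set.uIcc 0 t ∪ γ₂ '' Set.uIcc 0 t :=
    fun τ hτ => Or.inl ⟨τ, hτ, rfl⟩
  have m₂ : ∀ τ ∈ Set.uIcc 0 t, γ₂ τ ∈ γ₁ '' Set.uIcc 0 t ∪ γ₂ '' Set.uIcc 0 t :=
    fun τ hτ => Or.inr ⟨τ, hτ, rfl⟩
  rcases le_total 0 t with ht | ht
  · unfold IsFlowCurve at h₁ h₂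
    rw [Set.uIcc_of_le ht] at *
    refine ODE_solution_unique_of_mem_Icc_right (v := fun _ => f)
      (s := fun _ => γ₁ '' Set.Icc 0 t ∪ γ₂ '' Set.Icc 0 t) (K := K) (fun _ _ => hK) c₁ ?_
      (fun τ hτ => m₁ τ (Set.Ico_subset_Icc_self hτ)) c₂ ?_
      (fun τ hτ => m₂ τ (Set.Ico_subset_Icc_self hτ)) h0
    · exact fun τ hτ => ((h₁ τ (Set.Ico_subset_Icc_self hτ)).2).mono_of_mem_nhdsWithin
        (Icc_mem_nhdsGE_of_mem hτ)
    · exact fun τ hτ => ((h₂ τ (Set.Ico_subset_Icc_self hτ)).2).mono_of_mem_nhdsWithin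
        (Icc_mem_nhdsGE_of_mem hτ)
  · unfold IsFlowCurve at h₁ h₂
    rw [Set.uIcc_of_ge ht] at *
    refine ODE_solution_unique_of_mem_Icc_left (v := fun _ => f)
      (s := fun _ => γ₁ '' Set.Icc t 0 ∪ γ₂ '' Set.Icc t 0) (K := K) (fun _ _ => hK) c₁ ?_
      (fun τ hτ => m₁ τ (Set.Ioc_subset_Icc_self hτ)) c₂ ?_
      (fun τ hτ => m₂ τ (Set.Ioc_subset_Icc_self hτ)) h0
    · exact fun τ hτ => ((h₁ τ (Set.Ioc_subset_Icc_self hτ)).2).mono_of_mem_nhdsWithin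
        (Icc_mem_nhdsLE_of_mem hτ)
    · exact fun τ hτ => ((h₂ τ (Set.Ioc_subset_Icc_self hτ)).2).mono_of_mem_nhdsWithin
        (Icc_mem_nhdsLE_of_mem hτ)

theorem exactFlow_eq (hU : IsOpen U) (hf : ContDiffOn ℝ ∞ f U)
    {γ : ℝ → EuclideanSpace ℝ (Fin d)} {t : ℝ} {x : EuclideanSpace ℝ (Fin d)}
    (h : IsFlowCurve U f γ t) (h0 : γ 0 = x) : exactFlow U f t x = γ t := by
  have H : ∃ γ : ℝ → EuclideanSpace ℝ (Fin d), γ 0 = x ∧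
      ∀ τ ∈ Set.uIcc 0 t, γ τ ∈ U ∧ HasDerivWithinAt γ (f (γ τ)) (Set.uIcc 0 t) τ := ⟨γ, h0, h⟩
  rw [exactFlow, dif_pos H]
  exact IsFlowCurve.eqOn hU hf H.choose_spec.2 h (H.choose_spec.1.trans h0.symm)
    Set.right_mem_uIcc

theorem exactFlow_zero (x : EuclideanSpace ℝ (Fin d)) : exactFlow U f 0 x = x := by
  unfold exactFlow
  split_ifs with H
  · exact H.choose_spec.1
  · rfl

/-- Picard–Lindelöf provides a jointly continuous local flow; uniqueness identifies it with the
choice made in `exactFlow`. -/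
theorem exists_local_exactFlow (hU : IsOpen U) (hf : ContDiffOn ℝ ∞ f U)
    {x₀ : EuclideanSpace ℝ (Fin d)} (hx₀ : x₀ ∈ U) :
    ContinuousAt (fun q : ℝ × EuclideanSpace ℝ (Fin d) => exactFlow U f q.1 q.2) (0, x₀) ∧
    ∃ ε > 0, ∃ r > 0, ∀ x ∈ Metric.ball x₀ r, ∀ t : ℝ, |t| < ε → exactFlow U f t x ∈ U ∧
      HasDerivAt (fun τ => exactFlow U f τ x) (f (exactFlow U f t x)) t := by
  have hx' : ContDiffAt ℝ 1 f x₀ :=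
    ((hf x₀ hx₀).contDiffAt (hU.mem_nhds hx₀)).of_le (by norm_cast)
  obtain ⟨ε, hε, a, r, L, K, hr, hpl⟩ := IsPicardLindelof.of_contDiffAt_one hx'
  obtain ⟨α, hα, hαc⟩ :=
    (hpl 0).exists_forall_mem_closedBall_eq_hasDerivWithinAt_continuousOn
  have hnh : Metric.closedBall x₀ (r : ℝ) ×ˢ Set.Icc (0 - ε) (0 + ε) ∈ 𝓝 (x₀, (0 : ℝ)) :=
    prod_mem_nhds (Metric.closedBall_mem_nhds _ hr) (Icc_mem_nhds (by linarith) (by linarith))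
  have hαa : ContinuousAt α (x₀, 0) := hαc.continuousAt hnh
  have hα0 : α (x₀, 0) = x₀ := (hα x₀ (Metric.mem_closedBall_self r.2)).1
  -- The Picard–Lindelöf solution need not stay in `U`; continuity at `(x₀, 0)` ensures this after
  -- shrinking the neighbourhood.
  have hev : ∀ᶠ q in 𝓝 (x₀, (0 : ℝ)), α q ∈ U ∧
      q ∈ Metric.closedBall x₀ (r : ℝ) ×ˢ Set.Icc (0 - ε) (0 + ε) :=
    (hαa.eventually_mem (hU.mem_nhds (by rwa [hα0]))).and hnh
  obtain ⟨δ, hδ, hball⟩ := Metric.eventually_nhds_iff_ball.1 hev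
  have key : ∀ x ∈ Metric.ball x₀ δ, ∀ t : ℝ, |t| < δ → α (x, t) ∈ U ∧
      HasDerivAt (fun τ => α (x, τ)) (f (α (x, t))) t := by
    intro x hx t ht
    have hm : ∀ τ : ℝ, |τ| < δ → (x, τ) ∈ Metric.ball (x₀, (0 : ℝ)) δ := by
      intro τ hτ
      rw [← ball_prod_same]
      exact ⟨hx, by simpa [Metric.mem_ball, Real.dist_eq] using hτ⟩
    refine ⟨(hball _ (hm t ht)).1, ?_⟩
    have h2 := (hball _ (hm t ht)).2
    refine ((hα x h2.1).2 t h2.2).hasDerivAt ?_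
    have : ∀ᶠ τ : ℝ in 𝓝 t, |τ| < δ := (continuous_abs.tendsto t).eventually_lt_const ht
    filter_upwards [this] with τ hτ
    exact (hball _ (hm τ hτ)).2.2
  have heq : ∀ x ∈ Metric.ball x₀ δ, ∀ t : ℝ, |t| < δ → exactFlow U f t x = α (x, t) := by
    intro x hx t ht
    refine exactFlow_eq (γ := fun τ => α (x, τ)) hU hf (fun τ hτ => ?_) ?_
    · have hτ' : |τ| < δ := by
        have := Set.abs_sub_left_of_mem_uIcc hτ
        simp only [sub_zero] at this
        linarith
      exact ⟨(key x hx τ hτ').1, (key x hx τ hτ').2.hasDerivWithinAt⟩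
    · refine (hα x ?_).1
      have : (x, (0 : ℝ)) ∈ Metric.ball (x₀, (0 : ℝ)) δ := by
        rw [← ball_prod_same]
        exact ⟨hx, Metric.mem_ball_self hδ⟩
      exact (hball _ this).2.1
  refine ⟨?_, δ, hδ, δ, hδ, fun x hx t ht => ?_⟩
  · have h1 : ContinuousAt (fun q : ℝ × EuclideanSpace ℝ (Fin d) => α (q.2, q.1)) (0, x₀) :=
      ContinuousAt.comp (f := fun q : ℝ × EuclideanSpace ℝ (Fin d) => (q.2, q.1)) (g := α)
        (x := ((0 : ℝ), x₀)) hαa (by fun_prop)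
    refine h1.congr ?_
    filter_upwards [Metric.ball_mem_nhds ((0 : ℝ), x₀) hδ] with q hq
    rw [← ball_prod_same] at hq
    exact (heq q.2 hq.2 q.1 (by simpa [Metric.mem_ball, Real.dist_eq] using hq.1)).symm
  · rw [heq x hx t ht]
    refine ⟨(key x hx t ht).1, (key x hx t ht).2.congr_of_eventuallyEq ?_⟩
    have : ∀ᶠ τ : ℝ in 𝓝 t, |τ| < δ := (continuous_abs.tendsto t).eventually_lt_const ht
    filter_upwards [this] with τ hτ
    exact heq x hx τ hτ

/-- The group law is claimed only near step size zero, where the solution exists and the default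
value in `exactFlow` plays no role. The inductive step follows one trajectory from a shifted initial
time. -/
theorem eventually_exactFlow_iterate (hU : IsOpen U) (hf : ContDiffOn ℝ ∞ f U)
    {x₀ : EuclideanSpace ℝ (Fin d)} (hx₀ : x₀ ∈ U) (k : ℕ) :
    ∀ᶠ q : ℝ × EuclideanSpace ℝ (Fin d) in 𝓝 (0, x₀),
      (exactFlow U f q.1)^[k] q.2 = exactFlow U f (k * q.1) q.2 := by
  obtain ⟨-, ε, hε, r, hr, hloc⟩ := exists_local_exactFlow hU hf hx₀
  induction k with
  | zero => simp [exactFlow_zero]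
  | succ k ih =>
    have h1 : ∀ᶠ q : ℝ × EuclideanSpace ℝ (Fin d) in 𝓝 (0, x₀),
        |k * q.1| + |q.1| < ε := by
      have : ContinuousAt (fun q : ℝ × EuclideanSpace ℝ (Fin d) => |k * q.1| + |q.1|) (0, x₀) := by
        fun_prop
      exact this.eventually_lt_const (by simpa using hε)
    have h2 : ∀ᶠ q : ℝ × EuclideanSpace ℝ (Fin d) in 𝓝 (0, x₀), q.2 ∈ Metric.ball x₀ r :=
      continuousAt_snd.eventually_mem (Metric.ball_mem_nhds _ hr)
    filter_upwards [ih, h1, h2] with q hq hq1 hq2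
    rw [Function.iterate_succ_apply', hq]
    rw [exactFlow_eq (γ := fun τ => exactFlow U f (k * q.1 + τ) q.2) hU hf _ (by simp)]
    · push_cast; ring_nf
    · intro τ hτ
      have hτ' : |k * q.1 + τ| < ε := by
        have := Set.abs_sub_left_of_mem_uIcc hτ
        simp only [sub_zero] at this
        have := abs_add_le (k * q.1) τ
        linarith
      have := hloc q.2 hq2 _ hτ'
      exact ⟨this.1, (this.2.comp_const_add _ _).hasDerivWithinAt⟩

end Flow

/-! ### Powers of the step size as error gauges -/

section StepSize

variable {E F : Type*} [NormedAddCommGroup E] [NormedAddCommGroup F]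

theorem fst_pow_isBigO {a b : ℕ} (hab : a ≤ b) (x : E) :
    (fun q : ℝ × E => q.1 ^ b) =O[𝓝 ((0 : ℝ), x)] fun q => q.1 ^ a := by
  have h1 : ContinuousAt (fun q : ℝ × E => q.1 ^ (b - a)) (0, x) := by fun_prop
  have h2 := (h1.isBigO_one ℝ).mul (isBigO_refl (fun q : ℝ × E => q.1 ^ a) (𝓝 ((0 : ℝ), x)))
  simpa [← pow_add, Nat.sub_add_cancel hab] using h2

theorem tendsto_of_sub_isBigO {a b : ℝ × E → F} {x : E} {y : F} {n : ℕ}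
    (h : (fun q => a q - b q) =O[𝓝 ((0 : ℝ), x)] fun q => q.1 ^ (n + 1))
    (hb : Tendsto b (𝓝 ((0 : ℝ), x)) (𝓝 y)) : Tendsto a (𝓝 ((0 : ℝ), x)) (𝓝 y) := by
  have h1 : Tendsto (fun q : ℝ × E => q.1 ^ (n + 1)) (𝓝 ((0 : ℝ), x)) (𝓝 0) := by
    have : Continuous (fun q : ℝ × E => q.1 ^ (n + 1)) := by fun_prop
    exact this.tendsto' _ _ (by simp)
  simpa using (h.trans_tendsto h1).add hb

theorem tendsto_fst_prodMk {a : ℝ × E → E} {x : E} (h : Tendsto a (𝓝 ((0 : ℝ), x)) (𝓝 x)) :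
    Tendsto (fun q : ℝ × E => (q.1, a q)) (𝓝 ((0 : ℝ), x)) (𝓝 ((0 : ℝ), x)) := by
  rw [nhds_prod_eq] at h ⊢
  exact tendsto_fst.prodMk h

theorem tendsto_mul_fst (c : ℝ) (x : E) :
    Tendsto (fun q : ℝ × E => (c * q.1, q.2)) (𝓝 ((0 : ℝ), x)) (𝓝 ((0 : ℝ), x)) := by
  have : Continuous (fun q : ℝ × E => (c * q.1, q.2)) := by fun_prop
  exact this.tendsto' _ _ (by simp)

/-- The mean value inequality on the segment from `0` to `h`, with `x` fixed, gains one power of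
`h`. Balls of the product are products of balls, so one constant serves all nearby `x`. -/
theorem isBigO_pow_succ_of_hasDerivAt [NormedSpace ℝ F] {R R' : ℝ × E → F} {x₀ : E} {n : ℕ}
    (hR0 : ∀ᶠ x in 𝓝 x₀, R (0, x) = 0)
    (hR : ∀ᶠ q in 𝓝 ((0 : ℝ), x₀), HasDerivAt (fun h => R (h, q.2)) (R' q) q.1)
    (hO : R' =O[𝓝 ((0 : ℝ), x₀)] fun q => q.1 ^ n) :
    R =O[𝓝 ((0 : ℝ), x₀)] fun q => q.1 ^ (n + 1) := by
  obtain ⟨C, hC0, hC⟩ := hO.exists_nonneg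
  have hR0' : ∀ᶠ q in 𝓝 ((0 : ℝ), x₀), R (0, q.2) = 0 :=
    (continuousAt_snd (p := ((0 : ℝ), x₀))).tendsto.eventually hR0
  obtain ⟨δ, hδ, hball⟩ := Metric.eventually_nhds_iff_ball.1 (hR0'.and (hR.and hC.bound))
  refine IsBigO.of_bound C ?_
  filter_upwards [Metric.ball_mem_nhds ((0 : ℝ), x₀) hδ] with q hq
  have hq' := hq
  rw [← ball_prod_same] at hq'
  have habs : ∀ τ ∈ Set.uIcc 0 q.1, |τ| ≤ |q.1| := fun τ hτ => by
    have := Set.abs_sub_left_of_mem_uIcc hτ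
    simpa using this
  have hm : ∀ τ ∈ Set.uIcc 0 q.1, (τ, q.2) ∈ Metric.ball ((0 : ℝ), x₀) δ := by
    intro τ hτ
    rw [← ball_prod_same]
    refine ⟨?_, hq'.2⟩
    have h1 := hq'.1
    simp only [Metric.mem_ball, Real.dist_eq, sub_zero] at h1 ⊢
    exact (habs τ hτ).trans_lt h1
  have h := Convex.norm_image_sub_le_of_norm_hasDerivWithin_le (f := fun h => R (h, q.2))
    (f' := fun τ => R' (τ, q.2)) (C := C * |q.1| ^ n) (s := Set.uIcc 0 q.1)
    (fun τ hτ => (hball _ (hm τ hτ)).2.1.hasDerivWithinAt)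
    (fun τ hτ => ((hball _ (hm τ hτ)).2.2).trans (by
      simp only [norm_pow, Real.norm_eq_abs]
      have := habs τ hτ
      gcongr)) (convex_uIcc _ _) Set.left_mem_uIcc Set.right_mem_uIcc
  simp only [(hball q hq).1, sub_zero, Real.norm_eq_abs] at h
  simpa [pow_succ, mul_assoc] using h

end StepSize

/-! ### Expansions in the step size and smooth approximants -/

section Expansion

variable {E F : Type*} [NormedAddCommGroup E] [NormedSpace ℝ E] [NormedAddCommGroup F]
  [NormedSpace ℝ F]

theorem hasDerivAt_sum_pow_smul (c : ℕ → F) (n : ℕ) (h : ℝ) :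
    HasDerivAt (fun h : ℝ => ∑ m ∈ Finset.range (n + 1), h ^ m • ((m.factorial : ℝ)⁻¹ • c m))
      (∑ m ∈ Finset.range n, h ^ m • ((m.factorial : ℝ)⁻¹ • c (m + 1))) h := by
  have key : ∀ m ∈ Finset.range n, HasDerivAt
      (fun h : ℝ => h ^ (m + 1) • (((m + 1).factorial : ℝ)⁻¹ • c (m + 1)))
      (h ^ m • ((m.factorial : ℝ)⁻¹ • c (m + 1))) h := fun m _ => by
    convert! (hasDerivAt_pow (𝕜 := ℝ) (m + 1) h).smul_const
      (((m + 1).factorial : ℝ)⁻¹ • c (m + 1)) using 1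
    simp only [smul_smul, Nat.factorial_succ, Nat.add_sub_cancel]
    congr 1
    push_cast
    field_simp
  simp_rw [Finset.sum_range_succ', pow_zero]
  exact (HasDerivAt.fun_sum key).add_const _

theorem ContDiffAt.fderiv_apply_const {P : E → F} {x : E} (hP : ContDiffAt ℝ ∞ P x) (v : E) :
    ContDiffAt ℝ ∞ (fun y => fderiv ℝ P y v) x :=
  (hP.fderiv_right (m := ∞) (by norm_cast)).clm_apply contDiffAt_const

theorem ContDiffAt.eventually_hasDerivAt_fst {P : ℝ × E → F} {x₀ : E}
    (hP : ContDiffAt ℝ ∞ P (0, x₀)) :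
    ∀ᶠ q in 𝓝 ((0 : ℝ), x₀), HasDerivAt (fun h => P (h, q.2)) (fderiv ℝ P q (1, 0)) q.1 := by
  have h1 : ContDiffAt ℝ 1 P (0, x₀) := hP.of_le (by norm_cast)
  filter_upwards [h1.eventually (by simp)] with q hq
  have hd : HasFDerivAt P (fderiv ℝ P q) q := (hq.differentiableAt (by simp)).hasFDerivAt
  have hl : HasDerivAt (fun h : ℝ => (h, q.2)) ((1 : ℝ), (0 : E)) q.1 :=
    (hasDerivAt_id q.1).prodMk (hasDerivAt_const q.1 q.2)
  exact HasFDerivAt.comp_hasDerivAt (l := P) q.1 hd hl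

/-- The partial derivative with respect to the real variable. -/
noncomputable def stepDeriv (P : ℝ × E → F) : ℝ × E → F := fun q => fderiv ℝ P q (1, 0)

theorem contDiffAt_stepDeriv_iterate {P : ℝ × E → F} {q : ℝ × E} (hP : ContDiffAt ℝ ∞ P q)
    (m : ℕ) : ContDiffAt ℝ ∞ (stepDeriv^[m] P) q := by
  induction m with
  | zero => exact hP
  | succ m ih =>
    rw [Function.iterate_succ_apply']
    exact ih.fderiv_apply_const _

/-- Taylor's formula in `h` with `x` as a parameter: the remainder differentiates to the remainder
of `stepDeriv P` of one order less, so induction and the mean value bound suffice. -/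
theorem ContDiffAt.taylor_isBigO {P : ℝ × E → F} {x₀ : E} (hP : ContDiffAt ℝ ∞ P (0, x₀))
    (n : ℕ) :
    (fun q : ℝ × E => P q - ∑ m ∈ Finset.range n,
      q.1 ^ m • ((m.factorial : ℝ)⁻¹ • (stepDeriv^[m] P) (0, q.2)))
      =O[𝓝 ((0 : ℝ), x₀)] fun q => q.1 ^ n := by
  induction n generalizing P with
  | zero => simpa using hP.continuousAt.isBigO_one ℝ
  | succ n ih =>
    refine isBigO_pow_succ_of_hasDerivAt (Eventually.of_forall fun x => ?_) ?_
      (ih (hP.fderiv_apply_const (1, 0)))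
    · simp [Finset.sum_range_succ']
    · filter_upwards [hP.eventually_hasDerivAt_fst] with q hq
      exact hq.sub (hasDerivAt_sum_pow_smul (fun m => (stepDeriv^[m] P) (0, q.2)) n q.1)

theorem eq_zero_of_sum_pow_smul_isBigO {c : ℕ → F} {n : ℕ}
    (h : (fun t : ℝ => ∑ m ∈ Finset.range n, t ^ m • c m) =O[𝓝[≠] 0] fun t => t ^ n) :
    ∀ m < n, c m = 0 := by
  induction n generalizing c with
  | zero => simp
  | succ n ih =>
    have h0 : c 0 = 0 := by
      have h1 : Tendsto (fun t : ℝ => ∑ m ∈ Finset.range (n + 1), t ^ m • c m) (𝓝[≠] 0)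
          (𝓝 (c 0)) := by
        have : ContinuousAt (fun t : ℝ => ∑ m ∈ Finset.range (n + 1), t ^ m • c m) 0 := by
          fun_prop
        have h2 : ∑ m ∈ Finset.range (n + 1), (0 : ℝ) ^ m • c m = c 0 := by
          simp [Finset.sum_range_succ']
        exact (h2 ▸ this.tendsto).mono_left nhdsWithin_le_nhds
      have h2 : Tendsto (fun t : ℝ => t ^ (n + 1)) (𝓝[≠] 0) (𝓝 0) := by
        have : Continuous (fun t : ℝ => t ^ (n + 1)) := by fun_prop
        exact (this.tendsto' 0 0 (by simp)).mono_left nhdsWithin_le_nhds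
      exact tendsto_nhds_unique h1 (h.trans_tendsto h2)
    have hs : (fun t : ℝ => ∑ m ∈ Finset.range n, t ^ m • c (m + 1)) =O[𝓝[≠] 0]
        fun t => t ^ n := by
      obtain ⟨C, hC⟩ := h.bound
      refine IsBigO.of_bound C ?_
      filter_upwards [hC, self_mem_nhdsWithin] with t ht ht0
      have : ∑ m ∈ Finset.range (n + 1), t ^ m • c m
          = t • ∑ m ∈ Finset.range n, t ^ m • c (m + 1) := by
        simp [Finset.sum_range_succ', h0, Finset.smul_sum, smul_smul, pow_succ']
      rw [this, norm_smul, pow_succ', norm_mul, mul_left_comm] at ht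
      exact le_of_mul_le_mul_left ht (norm_pos_iff.2 ht0)
    rintro (_ | m) hm
    · exact h0
    · exact ih hs m (by omega)

/-- Near `{0} × U` the one-step method `Φ` agrees up to `O(h ^ (n + 1))` with a family of maps that
depends smoothly on the step size and is the identity for step size zero. -/
def HasSmoothApprox (U : Set E) (n : ℕ) (Φ : ℝ → E → E) : Prop :=
  ∃ P : ℝ × E → E, ∀ x ∈ U, ContDiffAt ℝ ∞ P (0, x) ∧ P (0, x) = x ∧
    (fun q : ℝ × E => Φ q.1 q.2 - P q) =O[𝓝 ((0 : ℝ), x)] fun q => q.1 ^ (n + 1)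

variable {U : Set E} {n : ℕ} {Φ Φ' Ψ Ψ' : ℝ → E → E}

theorem HasSmoothApprox.tendsto (h : HasSmoothApprox U n Φ) {x : E} (hx : x ∈ U) :
    Tendsto (fun q : ℝ × E => Φ q.1 q.2) (𝓝 ((0 : ℝ), x)) (𝓝 x) := by
  obtain ⟨P, hP⟩ := h
  obtain ⟨h1, h2, h3⟩ := hP x hx
  have h4 := h1.continuousAt.tendsto
  rw [h2] at h4
  exact tendsto_of_sub_isBigO h3 h4

theorem HasSmoothApprox.of_le {m : ℕ} (hmn : m ≤ n) (h : HasSmoothApprox U n Φ) :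
    HasSmoothApprox U m Φ := by
  obtain ⟨P, hP⟩ := h
  exact ⟨P, fun x hx => ⟨(hP x hx).1, (hP x hx).2.1,
    (hP x hx).2.2.trans (fst_pow_isBigO (by omega) x)⟩⟩

theorem HasSmoothApprox.sub_isBigO (hU : IsOpen U) (h : HasSmoothApprox U n Φ) {x : E}
    (hx : x ∈ U) : (fun q : ℝ × E => Φ q.1 q.2 - q.2) =O[𝓝 ((0 : ℝ), x)] fun q => q.1 ^ 1 := by
  obtain ⟨P, hP⟩ := h
  obtain ⟨h1, h2, h3⟩ := hP x hx
  have h4 : (fun q : ℝ × E => P q - q.2) =O[𝓝 ((0 : ℝ), x)] fun q => q.1 ^ (0 + 1) := by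
    refine isBigO_pow_succ_of_hasDerivAt (R' := stepDeriv P) ?_ ?_ ?_
    · filter_upwards [hU.mem_nhds hx] with y hy
      simp [(hP y hy).2.1]
    · filter_upwards [h1.eventually_hasDerivAt_fst] with q hq
      exact hq.sub_const q.2
    · simpa [stepDeriv] using (h1.fderiv_apply_const (1, 0)).continuousAt.isBigO_one ℝ
  simpa using (h3.trans (fst_pow_isBigO (by omega : 1 ≤ n + 1) x)).add h4

theorem HasSmoothApprox.id : HasSmoothApprox U n fun _ => id :=
  ⟨Prod.snd, fun x _ => ⟨contDiffAt_snd, rfl, by simpa using isBigO_zero _ _⟩⟩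

/-- The maps themselves may be irregular. The inner error passes through the outer approximant,
which is Lipschitz near `(0, x)`. -/
theorem HasSmoothApprox.comp (h' : HasSmoothApprox U n Φ') (h : HasSmoothApprox U n Φ) :
    HasSmoothApprox U n fun t => Φ' t ∘ Φ t := by
  have hh := h
  obtain ⟨P', hP'⟩ := h'
  obtain ⟨P, hP⟩ := h
  refine ⟨fun q => P' (q.1, P q), fun x hx => ?_⟩
  obtain ⟨h1, h2, h3⟩ := hP x hx
  obtain ⟨h1', h2', h3'⟩ := hP' x hx
  refine ⟨?_, by simp [h2, h2'], ?_⟩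
  · refine ContDiffAt.comp (g := P') (f := fun q : ℝ × E => (q.1, P q)) (0, x) ?_
      (contDiffAt_fst.prodMk h1)
    simpa [h2] using h1'
  · have t1 := tendsto_fst_prodMk (hh.tendsto hx)
    have t2 : Tendsto (fun q : ℝ × E => (q.1, P q)) (𝓝 ((0 : ℝ), x)) (𝓝 ((0 : ℝ), x)) := by
      refine tendsto_fst_prodMk ?_
      have h4 := h1.continuousAt.tendsto
      rwa [h2] at h4
    have a1 := h3'.comp_tendsto t1
    have a2 := ((h1'.hasStrictFDerivAt (by simp)).isBigO_sub).comp_tendsto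
      (nhds_prod_eq (x := ((0 : ℝ), x)) (y := ((0 : ℝ), x)) ▸ t1.prodMk t2)
    have a3 : (fun q : ℝ × E => P' (q.1, Φ q.1 q.2) - P' (q.1, P q)) =O[𝓝 ((0 : ℝ), x)]
        fun q => q.1 ^ (n + 1) := by
      refine (a2.trans (IsBigO.of_bound 1 (Eventually.of_forall fun q => ?_))).trans h3
      simp [Prod.norm_def]
    exact (a1.add a3).congr_left fun q => by simp

theorem HasSmoothApprox.comp_mul (c : ℝ) (h : HasSmoothApprox U n Φ) :
    HasSmoothApprox U n fun t => Φ (c * t) := by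
  obtain ⟨P, hP⟩ := h
  refine ⟨fun q => P (c * q.1, q.2), fun x hx => ?_⟩
  obtain ⟨h1, h2, h3⟩ := hP x hx
  refine ⟨?_, by simp [h2], (h3.comp_tendsto (tendsto_mul_fst c x)).trans ?_⟩
  · refine ContDiffAt.comp (g := P) (f := fun q : ℝ × E => (c * q.1, q.2)) (0, x) (by simpa) ?_
    fun_prop
  · simp only [Function.comp_def, mul_pow]
    exact (isBigO_refl _ _).const_mul_left _

theorem HasSmoothApprox.iterate (h : HasSmoothApprox U n Φ) (k : ℕ) :
    HasSmoothApprox U n fun t => (Φ t)^[k] := by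
  induction k with
  | zero => exact HasSmoothApprox.id
  | succ k ih =>
    simp_rw [Function.iterate_succ]
    exact ih.comp h

theorem HasSmoothApprox.altComp {A B : ℕ → ℝ → E → E} (hA : ∀ j, HasSmoothApprox U n (A j))
    (hB : ∀ j, HasSmoothApprox U n (B j)) (k : ℕ) :
    HasSmoothApprox U n fun t => altComp (fun j => A j t) (fun j => B j t) k := by
  induction k with
  | zero => exact HasSmoothApprox.id
  | succ k ih => exact (hB _).comp ((hA _).comp ih)

theorem hasSmoothApprox_of_coeff (hU : IsOpen U) {g : ℕ → E → E}
    (hg : ∀ m, ContDiffOn ℝ ∞ (g m) U) (hg0 : ∀ x ∈ U, g 0 x = x)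
    (h : ∀ x ∈ U, (fun q : ℝ × E => Φ q.1 q.2 - ∑ m ∈ Finset.range (n + 1), q.1 ^ m • g m q.2)
      =O[𝓝 ((0 : ℝ), x)] fun q => q.1 ^ (n + 1)) : HasSmoothApprox U n Φ := by
  refine ⟨fun q => ∑ m ∈ Finset.range (n + 1), q.1 ^ m • g m q.2, fun x hx => ⟨?_, ?_, h x hx⟩⟩
  · refine ContDiffAt.sum fun m _ => (contDiffAt_fst.pow m).smul ?_
    have : ContDiffAt ℝ ∞ (g m) x := (hg m x hx).contDiffAt (hU.mem_nhds hx)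
    exact ContDiffAt.comp (g := g m) (f := Prod.snd) ((0 : ℝ), x) this contDiffAt_snd
  · simp [Finset.sum_range_succ', hg0 x hx]

theorem HasSmoothApprox.exists_coeff (h : HasSmoothApprox U n Φ) :
    ∃ g : ℕ → E → E, (∀ m, ContDiffOn ℝ ∞ (g m) U) ∧ (∀ x ∈ U, g 0 x = x) ∧
      ∀ x ∈ U, (fun q : ℝ × E => Φ q.1 q.2 - ∑ m ∈ Finset.range (n + 1), q.1 ^ m • g m q.2)
        =O[𝓝 ((0 : ℝ), x)] fun q => q.1 ^ (n + 1) := by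
  obtain ⟨P, hP⟩ := h
  refine ⟨fun m x => (m.factorial : ℝ)⁻¹ • (stepDeriv^[m] P) (0, x), fun m => ?_, fun x hx => ?_,
    fun x hx => ?_⟩
  · intro x hx
    refine ContDiffAt.contDiffWithinAt (contDiffAt_const.smul ?_)
    exact ContDiffAt.comp (g := stepDeriv^[m] P) (f := fun y : E => ((0 : ℝ), y)) x
      (contDiffAt_stepDeriv_iterate (hP x hx).1 m) (by fun_prop)
  · simp [(hP x hx).2.1]
  · simpa using (hP x hx).2.2.add ((hP x hx).1.taylor_isBigO (n + 1))

theorem sum_smul_isBigO_of_le (hU : IsOpen U) {g : ℕ → E → E} (hg : ∀ m, ContDiffOn ℝ ∞ (g m) U)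
    {a b : ℕ} (hab : a ≤ b) {x : E} (hx : x ∈ U) :
    (fun q : ℝ × E => ∑ m ∈ Finset.range b, q.1 ^ m • g m q.2
      - ∑ m ∈ Finset.range a, q.1 ^ m • g m q.2) =O[𝓝 ((0 : ℝ), x)] fun q => q.1 ^ a := by
  simp only [← Finset.sum_Ico_eq_sub _ hab]
  have key : ∀ m ∈ Finset.Ico a b, (fun q : ℝ × E => q.1 ^ m • g m q.2) =O[𝓝 ((0 : ℝ), x)]
      fun q => q.1 ^ a := fun m hm => by
    have hc : ContinuousAt (fun q : ℝ × E => g m q.2) (0, x) :=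
      ContinuousAt.comp (g := g m) (f := Prod.snd) (x := ((0 : ℝ), x))
        (((hg m).continuousOn).continuousAt (hU.mem_nhds hx)) continuousAt_snd
    simpa using (fst_pow_isBigO (Finset.mem_Ico.1 hm).1 x).smul (hc.isBigO_one ℝ)
  simpa only [Finset.sum_fn] using IsBigO.sum key

/-- The coefficients of an expansion are unique. -/
theorem coeff_unique {g g' : ℕ → E → E} {x : E}
    (h : (fun q : ℝ × E => Φ q.1 q.2 - ∑ m ∈ Finset.range n, q.1 ^ m • g m q.2)
      =O[𝓝 ((0 : ℝ), x)] fun q => q.1 ^ n)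
    (h' : (fun q : ℝ × E => Φ q.1 q.2 - ∑ m ∈ Finset.range n, q.1 ^ m • g' m q.2)
      =O[𝓝 ((0 : ℝ), x)] fun q => q.1 ^ n) : ∀ m < n, g m x = g' m x := by
  have t : Tendsto (fun t : ℝ => (t, x)) (𝓝[≠] 0) (𝓝 ((0 : ℝ), x)) := by
    have : Continuous fun t : ℝ => (t, x) := by fun_prop
    exact (this.tendsto' _ _ rfl).mono_left nhdsWithin_le_nhds
  have h1 := (h'.sub h).comp_tendsto t
  intro m hm
  refine sub_eq_zero.1
    (eq_zero_of_sum_pow_smul_isBigO (c := fun m => g m x - g' m x) (n := n) ?_ m hm)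
  refine h1.congr_left fun t => ?_
  simp [smul_sub, Finset.sum_sub_distrib]

/-- For `N = ⊤` each order comes with its own approximant. The `m`-th coefficient is taken from the
expansion of order `m`; by uniqueness it agrees with that of every longer expansion. -/
theorem exists_coeff_of_forall_hasSmoothApprox (hU : IsOpen U) {N : ℕ∞}
    (h : ∀ n : ℕ, (n : ℕ∞) ≤ N → HasSmoothApprox U n Φ) :
    ∃ g : ℕ → E → E, (∀ m, ContDiffOn ℝ ∞ (g m) U) ∧ (∀ x ∈ U, g 0 x = x) ∧
      ∀ n : ℕ, (n : ℕ∞) ≤ N → ∀ x ∈ U,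
        (fun q : ℝ × E => Φ q.1 q.2 - ∑ m ∈ Finset.range (n + 1), q.1 ^ m • g m q.2)
          =O[𝓝 ((0 : ℝ), x)] fun q => q.1 ^ (n + 1) := by
  classical
  choose G hG1 hG2 hG3 using fun (n : ℕ) (hn : (n : ℕ∞) ≤ N) => (h n hn).exists_coeff
  refine ⟨fun m => if hm : (m : ℕ∞) ≤ N then G m hm m else 0, fun m => ?_, fun x hx => ?_,
    fun n hn x hx => ?_⟩
  · dsimp only
    split_ifs with hm
    · exact hG1 m hm m
    · exact contDiffOn_const
  · simpa using hG2 0 (by simp) x hx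
  · refine (hG3 n hn x hx).congr' ?_ EventuallyEq.rfl
    have hUn : ∀ᶠ q : ℝ × E in 𝓝 ((0 : ℝ), x), q.2 ∈ U :=
      continuousAt_snd.eventually_mem (hU.mem_nhds hx)
    filter_upwards [hUn] with q hq
    congr 1
    refine Finset.sum_congr rfl fun m hm => ?_
    have hmn : m ≤ n := by simpa [Nat.lt_succ_iff] using hm
    have hm' : (m : ℕ∞) ≤ N := le_trans (by exact_mod_cast hmn) hn
    rw [dif_pos hm']
    congr 1
    refine coeff_unique (Φ := Φ) (n := m + 1) ?_ (hG3 m hm' q.2 hq) m (by omega)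
    simpa using ((hG3 n hn q.2 hq).trans (fst_pow_isBigO (by omega) _)).add
      (sum_smul_isBigO_of_le hU (hG1 n hn) (show m + 1 ≤ n + 1 by omega) hq)

/-! ### Calculus of leading defects -/

/-- `Φ_h - Ψ_h = h ^ k e + O(h ^ (k + 1))` as `h → 0`, locally uniformly on `U`. -/
def HasDefect (U : Set E) (k : ℕ) (Φ Ψ : ℝ → E → E) (e : E → E) : Prop :=
  ∀ x ∈ U, (fun q : ℝ × E => Φ q.1 q.2 - Ψ q.1 q.2 - q.1 ^ k • e q.2)
    =O[𝓝 ((0 : ℝ), x)] fun q => q.1 ^ (k + 1)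

variable {k : ℕ} {e e' : E → E}

theorem HasDefect.refl (Φ : ℝ → E → E) : HasDefect U k Φ Φ 0 := fun x _ => by
  simpa using isBigO_zero _ _

theorem HasDefect.trans {Ξ : ℝ → E → E} (h : HasDefect U k Φ Ψ e) (h' : HasDefect U k Ψ Ξ e') :
    HasDefect U k Φ Ξ (e + e') := fun x hx => by
  refine ((h x hx).add (h' x hx)).congr_left fun q => ?_
  simp only [Pi.add_apply, smul_add]
  abel

theorem HasDefect.comp_mul (c : ℝ) (h : HasDefect U k Φ Ψ e) :
    HasDefect U k (fun t => Φ (c * t)) (fun t => Ψ (c * t)) (c ^ k • e) := fun x hx => by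
  have h1 := (h x hx).comp_tendsto (tendsto_mul_fst c x)
  simp only [Function.comp_def, mul_pow] at h1
  refine (h1.trans ((isBigO_refl _ _).const_mul_left _)).congr_left fun q => ?_
  simp [smul_smul, mul_comm]

theorem HasDefect.congr_right (h : HasDefect U k Φ Ψ e)
    (hΨ : ∀ x ∈ U, ∀ᶠ q in 𝓝 ((0 : ℝ), x), Ψ q.1 q.2 = Ψ' q.1 q.2) :
    HasDefect U k Φ Ψ' e := fun x hx => by
  refine (h x hx).congr' ?_ EventuallyEq.rfl
  filter_upwards [hΨ x hx] with q hq
  rw [hq]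

/-- The left side vanishes at `h = 0`, and its `h`-derivative is Lipschitz in the space variable.
Thus a near-identity family transports differences unchanged up to a factor `O(h)`. -/
theorem ContDiffAt.sub_sub_isBigO {P : ℝ × E → E} {x₀ : E} (hP : ContDiffAt ℝ ∞ P (0, x₀))
    (hP0 : ∀ᶠ x in 𝓝 x₀, P (0, x) = x) :
    (fun r : ℝ × E × E => P (r.1, r.2.1) - P (r.1, r.2.2) - (r.2.1 - r.2.2))
      =O[𝓝 ((0 : ℝ), x₀, x₀)] fun r => r.1 * ‖r.2.1 - r.2.2‖ := by
  obtain ⟨K, s, hs, hK⟩ := ((hP.fderiv_apply_const (1, 0)).of_le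
    (by norm_cast : (1 : WithTop ℕ∞) ≤ ∞)).exists_lipschitzOnWith
  have hP0' : ∀ᶠ q in 𝓝 ((0 : ℝ), x₀), P (0, q.2) = q.2 :=
    (continuousAt_snd (p := ((0 : ℝ), x₀))).tendsto.eventually hP0
  obtain ⟨δ, hδ, hball⟩ := Metric.eventually_nhds_iff_ball.1
    (hP0'.and (hP.eventually_hasDerivAt_fst.and hs))
  refine IsBigO.of_bound K ?_
  filter_upwards [Metric.ball_mem_nhds ((0 : ℝ), x₀, x₀) hδ] with q hq
  rw [← ball_prod_same, ← ball_prod_same] at hq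
  obtain ⟨h1, h2, h3⟩ := hq
  have habs : ∀ τ ∈ Set.uIcc 0 q.1, |τ| ≤ |q.1| := fun τ hτ => by
    have := Set.abs_sub_left_of_mem_uIcc hτ
    simpa using this
  have hm : ∀ τ ∈ Set.uIcc 0 q.1, ∀ y ∈ Metric.ball x₀ δ, (τ, y) ∈ Metric.ball ((0 : ℝ), x₀) δ := by
    intro τ hτ y hy
    rw [← ball_prod_same]
    refine ⟨?_, hy⟩
    simp only [Metric.mem_ball, Real.dist_eq, sub_zero] at h1 ⊢
    exact (habs τ hτ).trans_lt h1
  have h := Convex.norm_image_sub_le_of_norm_hasDerivWithin_le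
    (f := fun h => P (h, q.2.1) - P (h, q.2.2))
    (f' := fun τ => fderiv ℝ P (τ, q.2.1) (1, 0) - fderiv ℝ P (τ, q.2.2) (1, 0))
    (C := K * ‖q.2.1 - q.2.2‖) (s := Set.uIcc 0 q.1)
    (fun τ hτ => ((hball _ (hm τ hτ _ h2)).2.1.sub
      (hball _ (hm τ hτ _ h3)).2.1).hasDerivWithinAt)
    (fun τ hτ => by
      have := hK.norm_sub_le (hball _ (hm τ hτ _ h2)).2.2 (hball _ (hm τ hτ _ h3)).2.2
      simpa [Prod.norm_def] using this) (convex_uIcc _ _) Set.left_mem_uIcc Set.right_mem_uIcc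
  have e2 := (hball _ (hm 0 Set.left_mem_uIcc _ h2)).1
  have e3 := (hball _ (hm 0 Set.left_mem_uIcc _ h3)).1
  simp only at e2 e3
  simp only [e2, e3, sub_zero] at h
  simpa [mul_assoc, mul_comm, mul_left_comm] using h

/-- Two effects must be of higher order: `Ψ'` moves the defect of `Φ` only by a relative `O(h)`, and
evaluating `e'` at `Φ` rather than at the base point also costs a factor `O(h)`. -/
theorem HasDefect.comp (hU : IsOpen U) (h' : HasDefect U k Φ' Ψ' e') (h : HasDefect U k Φ Ψ e)
    (hΨ' : HasSmoothApprox U k Ψ') (hΦ : HasSmoothApprox U k Φ) (hΨ : HasSmoothApprox U k Ψ)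
    (he' : ContDiffOn ℝ ∞ e' U) (he : ContDiffOn ℝ ∞ e U) :
    HasDefect U k (fun t => Φ' t ∘ Φ t) (fun t => Ψ' t ∘ Ψ t) (e' + e) := fun x hx => by
  obtain ⟨P, hP⟩ := hΨ'
  obtain ⟨p1, -, p3⟩ := hP x hx
  have hP0 : ∀ᶠ y in 𝓝 x, P (0, y) = y := by
    filter_upwards [hU.mem_nhds hx] with y hy using (hP y hy).2.1
  have tΦ := tendsto_fst_prodMk (hΦ.tendsto hx)
  have tΨ := tendsto_fst_prodMk (hΨ.tendsto hx)
  have t3 : Tendsto (fun q : ℝ × E => (q.1, Φ q.1 q.2, Ψ q.1 q.2)) (𝓝 ((0 : ℝ), x))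
      (𝓝 ((0 : ℝ), x, x)) := by
    have a := hΦ.tendsto hx
    have b := hΨ.tendsto hx
    exact (continuousAt_fst (p := ((0 : ℝ), x))).tendsto.prodMk_nhds (a.prodMk_nhds b)
  have h1 := (h' x hx).comp_tendsto tΦ
  have h2 := p3.comp_tendsto tΦ
  have h3 := p3.comp_tendsto tΨ
  have hd : (fun q : ℝ × E => Φ q.1 q.2 - Ψ q.1 q.2) =O[𝓝 ((0 : ℝ), x)] fun q => q.1 ^ k := by
    have hc : ContinuousAt (fun q : ℝ × E => e q.2) (0, x) :=
      ContinuousAt.comp (g := e) (f := Prod.snd) (x := ((0 : ℝ), x))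
        (he.continuousOn.continuousAt (hU.mem_nhds hx)) continuousAt_snd
    have a := (isBigO_refl (fun q : ℝ × E => q.1 ^ k) (𝓝 ((0 : ℝ), x))).smul (hc.isBigO_one ℝ)
    have b := ((h x hx).trans (fst_pow_isBigO (Nat.le_succ k) x)).add (by simpa using a)
    simpa using b
  have h4 : (fun q : ℝ × E => P (q.1, Φ q.1 q.2) - P (q.1, Ψ q.1 q.2)
      - (Φ q.1 q.2 - Ψ q.1 q.2)) =O[𝓝 ((0 : ℝ), x)] fun q => q.1 ^ (k + 1) := by
    refine ((p1.sub_sub_isBigO hP0).comp_tendsto t3).trans ?_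
    simp_rw [pow_succ']
    exact (isBigO_refl _ _).mul hd.norm_left
  have h6 : (fun q : ℝ × E => q.1 ^ k • (e' (Φ q.1 q.2) - e' q.2)) =O[𝓝 ((0 : ℝ), x)]
      fun q => q.1 ^ (k + 1) := by
    have s : HasStrictFDerivAt e' (fderiv ℝ e' x) x :=
      ((he' x hx).contDiffAt (hU.mem_nhds hx)).hasStrictFDerivAt (by simp)
    have t : Tendsto (fun q : ℝ × E => (Φ q.1 q.2, q.2)) (𝓝 ((0 : ℝ), x)) (𝓝 (x, x)) :=
      (hΦ.tendsto hx).prodMk_nhds (continuousAt_snd (p := ((0 : ℝ), x))).tendsto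
    have a := (s.isBigO_sub.comp_tendsto t).trans (hΦ.sub_isBigO hU hx)
    simpa [pow_succ] using (isBigO_refl (fun q : ℝ × E => q.1 ^ k) (𝓝 ((0 : ℝ), x))).smul a
  -- Telescoping: `h1` replaces `Φ'` by `Ψ'`, `h2` and `h3` replace `Ψ'` by its approximant, `h4`
  -- and the defect of `Φ` treat the inner difference, and `h6` moves the base point of `e'`.
  refine ((((h1.add h2).sub h3).add h4).add ((h x hx).add h6)).congr_left fun q => ?_
  simp only [Function.comp_apply, Pi.add_apply, smul_add, smul_sub]
  abel

theorem HasDefect.iterate (hU : IsOpen U) (h : HasDefect U k Φ Ψ e) (hΦ : HasSmoothApprox U k Φ)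
    (hΨ : HasSmoothApprox U k Ψ) (he : ContDiffOn ℝ ∞ e U) (m : ℕ) :
    HasDefect U k (fun t => (Φ t)^[m]) (fun t => (Ψ t)^[m]) ((m : ℝ) • e) := by
  induction m with
  | zero => simpa using HasDefect.refl (U := U) (k := k) fun _ => _root_.id
  | succ m ih =>
    have := ih.comp hU h (hΨ.iterate m) hΦ hΨ (contDiffOn_const.smul he) he
    push_cast
    rw [add_smul, one_smul]
    exact this

theorem HasDefect.altComp (hU : IsOpen U) {A B A' B' : ℕ → ℝ → E → E} {eA eB : ℕ → E → E}
    (hA : ∀ j, HasSmoothApprox U k (A j)) (hB : ∀ j, HasSmoothApprox U k (B j))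
    (hA' : ∀ j, HasSmoothApprox U k (A' j)) (hB' : ∀ j, HasSmoothApprox U k (B' j))
    (heA : ∀ j, ContDiffOn ℝ ∞ (eA j) U) (heB : ∀ j, ContDiffOn ℝ ∞ (eB j) U)
    (dA : ∀ j, HasDefect U k (A j) (A' j) (eA j)) (dB : ∀ j, HasDefect U k (B j) (B' j) (eB j))
    (n : ℕ) :
    HasDefect U k (fun t => altComp (fun j => A j t) (fun j => B j t) n)
      (fun t => altComp (fun j => A' j t) (fun j => B' j t) n)
      (∑ j ∈ Finset.Icc 1 n, (eA j + eB j)) := by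
  have hs : ∀ n, ContDiffOn ℝ ∞ (∑ j ∈ Finset.Icc 1 n, (eA j + eB j)) U := fun n => by
    rw [Finset.sum_fn]
    exact ContDiffOn.sum fun j _ => (heA j).add (heB j)
  induction n with
  | zero => exact HasDefect.refl (U := U) (k := k) fun _ => _root_.id
  | succ n ih =>
    have := (dB (n + 1)).comp hU ((dA (n + 1)).comp hU ih (hA' _) (HasSmoothApprox.altComp hA hB n)
      (HasSmoothApprox.altComp hA' hB' n) (heA _) (hs n)) (hB' _)
      ((hA _).comp (HasSmoothApprox.altComp hA hB n))
      ((hA' _).comp (HasSmoothApprox.altComp hA' hB' n)) (heB _) ((heA _).add (hs n))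
    rw [Finset.sum_Icc_succ_top (by omega)]
    rw [add_comm (Finset.sum _ _), add_comm (eA _) (eB _), add_assoc]
    exact this

end Expansion

/-! ### Lie series, formal exponential and formal logarithm -/

section LieSeries

variable {d : ℕ} {U : Set (EuclideanSpace ℝ (Fin d))}
  {f g f' g' : EuclideanSpace ℝ (Fin d) → EuclideanSpace ℝ (Fin d)}
  {Y Y' : ℕ → EuclideanSpace ℝ (Fin d) → EuclideanSpace ℝ (Fin d)}

theorem ContDiffOn.lieDeriv (hU : IsOpen U) (hf : ContDiffOn ℝ ∞ f U) (hg : ContDiffOn ℝ ∞ g U) :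
    ContDiffOn ℝ ∞ (lieDeriv f g) U :=
  (hg.fderiv_of_isOpen hU (by norm_cast)).clm_apply hf

theorem ContDiffOn.lieDeriv_iterate (hU : IsOpen U) (hf : ContDiffOn ℝ ∞ f U)
    (hg : ContDiffOn ℝ ∞ g U) (m : ℕ) : ContDiffOn ℝ ∞ ((_root_.lieDeriv f)^[m] g) U := by
  induction m with
  | zero => exact hg
  | succ m ih =>
    rw [Function.iterate_succ_apply']
    exact hf.lieDeriv hU ih

/-- Along the flow, differentiating `g` in time replaces it by `lieDeriv f g`. The induction
therefore runs over all smooth `g`. -/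
theorem exactFlow_taylor (hU : IsOpen U) (hf : ContDiffOn ℝ ∞ f U) (hg : ContDiffOn ℝ ∞ g U)
    {x₀ : EuclideanSpace ℝ (Fin d)} (hx₀ : x₀ ∈ U) (n : ℕ) :
    (fun q : ℝ × EuclideanSpace ℝ (Fin d) => g (exactFlow U f q.1 q.2)
      - ∑ m ∈ Finset.range n, q.1 ^ m • ((m.factorial : ℝ)⁻¹ • ((lieDeriv f)^[m] g) q.2))
      =O[𝓝 ((0 : ℝ), x₀)] fun q => q.1 ^ n := by
  obtain ⟨hc, ε, hε, r, hr, hloc⟩ := exists_local_exactFlow hU hf hx₀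
  induction n generalizing g with
  | zero =>
    have hgc : ContinuousAt g (exactFlow U f ((0 : ℝ), x₀).1 ((0 : ℝ), x₀).2) := by
      rw [exactFlow_zero]
      exact hg.continuousOn.continuousAt (hU.mem_nhds hx₀)
    have : ContinuousAt (fun q : ℝ × EuclideanSpace ℝ (Fin d) => g (exactFlow U f q.1 q.2))
      (0, x₀) := ContinuousAt.comp (g := g) hgc hc
    simpa using this.isBigO_one ℝ
  | succ n ih =>
    refine isBigO_pow_succ_of_hasDerivAt (Eventually.of_forall fun x => ?_) ?_
      (ih (hf.lieDeriv hU hg))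
    · simp [Finset.sum_range_succ', exactFlow_zero]
    · have h1 : ∀ᶠ q : ℝ × EuclideanSpace ℝ (Fin d) in 𝓝 (0, x₀), q.2 ∈ Metric.ball x₀ r :=
        continuousAt_snd.eventually_mem (Metric.ball_mem_nhds _ hr)
      have h2 : ∀ᶠ q : ℝ × EuclideanSpace ℝ (Fin d) in 𝓝 (0, x₀), |q.1| < ε :=
        (continuousAt_fst.abs).eventually_lt_const (by simpa using hε)
      filter_upwards [h1, h2] with q hq1 hq2
      obtain ⟨hqU, hq⟩ := hloc q.2 hq1 q.1 hq2
      have hgd : HasFDerivAt g (fderiv ℝ g (exactFlow U f q.1 q.2)) (exactFlow U f q.1 q.2) :=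
        (((hg _ hqU).contDiffAt (hU.mem_nhds hqU)).differentiableAt (by simp)).hasFDerivAt
      have h3 := HasFDerivAt.comp_hasDerivAt (l := g) q.1 hgd hq
      exact h3.sub (hasDerivAt_sum_pow_smul (fun m => ((lieDeriv f)^[m] g) q.2) n q.1)

theorem exactFlow_expansion (hU : IsOpen U) (hf : ContDiffOn ℝ ∞ f U)
    {x₀ : EuclideanSpace ℝ (Fin d)} (hx₀ : x₀ ∈ U) (n : ℕ) :
    (fun q : ℝ × EuclideanSpace ℝ (Fin d) => exactFlow U f q.1 q.2
      - ∑ m ∈ Finset.range n, q.1 ^ m • ((m.factorial : ℝ)⁻¹ • (lieDeriv f)^[m] id) q.2)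
      =O[𝓝 ((0 : ℝ), x₀)] fun q => q.1 ^ n :=
  exactFlow_taylor hU hf contDiffOn_id hx₀ n

theorem hasSmoothApprox_exactFlow (hU : IsOpen U) (hf : ContDiffOn ℝ ∞ f U) (n : ℕ) :
    HasSmoothApprox U n (exactFlow U f) :=
  hasSmoothApprox_of_coeff hU (g := fun m => (m.factorial : ℝ)⁻¹ • (lieDeriv f)^[m] id)
    (fun m => contDiffOn_const.smul (hf.lieDeriv_iterate hU contDiffOn_id m)) (fun x _ => by simp)
    fun _ hx => exactFlow_expansion hU hf hx _

theorem lieDeriv_congr (hU : IsOpen U) (hf : Set.EqOn f f' U) (hg : Set.EqOn g g' U) :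
    Set.EqOn (lieDeriv f g) (lieDeriv f' g') U := fun x hx => by
  rw [lieDeriv, lieDeriv, hf hx, (hg.eventuallyEq_of_mem (hU.mem_nhds hx)).fderiv_eq]

theorem lieDeriv_zero_left : lieDeriv (0 : EuclideanSpace ℝ (Fin d) → EuclideanSpace ℝ (Fin d)) g
    = 0 := by
  ext1 x
  simp [lieDeriv]

theorem lieDeriv_zero_right :
    lieDeriv f (0 : EuclideanSpace ℝ (Fin d) → EuclideanSpace ℝ (Fin d)) = 0 := by
  ext1 x
  simp [lieDeriv]

theorem lieDeriv_id_right : lieDeriv f id = f := by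
  ext1 x
  simp [lieDeriv]

theorem contDiffOn_powCoeff (hU : IsOpen U) (hY : ∀ k, ContDiffOn ℝ ∞ (Y k) U) (r m : ℕ) :
    ContDiffOn ℝ ∞ (powCoeff Y r m) U := by
  induction r generalizing m with
  | zero =>
    unfold powCoeff
    split_ifs
    · exact contDiffOn_id
    · exact contDiffOn_const
  | succ r ih =>
    unfold powCoeff
    rw [Finset.sum_fn]
    exact ContDiffOn.sum fun i _ => (hY i.1).lieDeriv hU (ih i.2)

theorem powCoeff_congr (hU : IsOpen U) {m : ℕ} (h : ∀ k ≤ m, Set.EqOn (Y k) (Y' k) U) (r : ℕ) :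
    Set.EqOn (powCoeff Y r m) (powCoeff Y' r m) U := by
  induction r generalizing m with
  | zero => exact fun x _ => rfl
  | succ r ih =>
    intro x hx
    unfold powCoeff
    simp only [Finset.sum_apply]
    refine Finset.sum_congr rfl fun i hi => ?_
    have hi' := Finset.HasAntidiagonal.mem_antidiagonal.1 hi
    exact lieDeriv_congr hU (h _ (by omega)) (ih fun k hk => h k (by omega)) hx

theorem powCoeff_succ_zero (hY : Set.EqOn (Y 0) 0 U) (r : ℕ) :
    Set.EqOn (powCoeff Y (r + 1) 0) 0 U := fun x hx => by
  simp [powCoeff, lieDeriv, hY hx]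

/-- With at least two factors and `Y 0 = 0`, every factor in a term of total degree `m` has degree
less than `m`. This makes the equations for the formal logarithm triangular. -/
theorem powCoeff_congr_of_lt (hU : IsOpen U) {m : ℕ} (hY : Set.EqOn (Y 0) 0 U)
    (hY' : Set.EqOn (Y' 0) 0 U) (h : ∀ k < m, Set.EqOn (Y k) (Y' k) U) (r : ℕ) :
    Set.EqOn (powCoeff Y (r + 2) m) (powCoeff Y' (r + 2) m) U := by
  intro x hx
  rw [powCoeff, powCoeff]
  simp only [Finset.sum_apply]
  refine Finset.sum_congr rfl fun i hi => ?_
  have hi' := Finset.HasAntidiagonal.mem_antidiagonal.1 hi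
  rcases Nat.eq_zero_or_pos i.1 with h0 | h0
  · simp [lieDeriv, h0, hY hx, hY' hx]
  rcases Nat.eq_zero_or_pos i.2 with h1 | h1
  · rw [h1, lieDeriv_congr hU (fun _ _ => rfl) (powCoeff_succ_zero hY r) hx,
      lieDeriv_congr hU (fun _ _ => rfl) (powCoeff_succ_zero hY' r) hx]
    simp [lieDeriv_zero_right]
  · exact lieDeriv_congr hU (h _ (by omega))
      (powCoeff_congr hU (fun k hk => h k (by omega)) _) hx

theorem powCoeff_one (m : ℕ) : powCoeff Y 1 m = Y m := by
  rw [powCoeff, Finset.sum_eq_single (m, 0)]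
  · simp [powCoeff, lieDeriv_id_right]
  · intro i hi hne
    have hi' := Finset.HasAntidiagonal.mem_antidiagonal.1 hi
    have : i.2 ≠ 0 := fun h => hne (Prod.ext (by simp; omega) h)
    simp [powCoeff, this, lieDeriv_zero_right]
  · intro h
    simp at h

/-- The part of the coefficient of `h ^ m` in `exp(D(h)) Id` that is not linear in `D(h)`. -/
noncomputable def nonlinearCoeff
    (Y : ℕ → EuclideanSpace ℝ (Fin d) → EuclideanSpace ℝ (Fin d)) (m : ℕ) :
    EuclideanSpace ℝ (Fin d) → EuclideanSpace ℝ (Fin d) :=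
  ∑ r ∈ Finset.Ico 2 (m + 1), ((r.factorial : ℝ)⁻¹) • powCoeff Y r m

theorem expCoeff_zero : expCoeff Y 0 = id := by
  simp [expCoeff, powCoeff]

theorem expCoeff_eq_add {m : ℕ} (hm : 1 ≤ m) : expCoeff Y m = Y m + nonlinearCoeff Y m := by
  rw [expCoeff, nonlinearCoeff, Finset.range_eq_Ico, Finset.sum_eq_sum_Ico_succ_bot (by omega),
    Finset.sum_eq_sum_Ico_succ_bot (by omega), powCoeff_one]
  simp [powCoeff, show m ≠ 0 by omega]

theorem contDiffOn_nonlinearCoeff (hU : IsOpen U) (hY : ∀ k, ContDiffOn ℝ ∞ (Y k) U) (m : ℕ) :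
    ContDiffOn ℝ ∞ (nonlinearCoeff Y m) U := by
  unfold nonlinearCoeff
  rw [Finset.sum_fn]
  exact ContDiffOn.sum fun r _ => contDiffOn_const.smul (contDiffOn_powCoeff hU hY r m)

theorem contDiffOn_expCoeff (hU : IsOpen U) (hY : ∀ k, ContDiffOn ℝ ∞ (Y k) U) (m : ℕ) :
    ContDiffOn ℝ ∞ (expCoeff Y m) U := by
  unfold expCoeff
  rw [Finset.sum_fn]
  exact ContDiffOn.sum fun r _ => contDiffOn_const.smul (contDiffOn_powCoeff hU hY r m)

theorem nonlinearCoeff_congr (hU : IsOpen U) {m : ℕ} (hY : Set.EqOn (Y 0) 0 U)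
    (hY' : Set.EqOn (Y' 0) 0 U) (h : ∀ k < m, Set.EqOn (Y k) (Y' k) U) :
    Set.EqOn (nonlinearCoeff Y m) (nonlinearCoeff Y' m) U := by
  intro x hx
  simp only [nonlinearCoeff, Finset.sum_apply, Pi.smul_apply]
  refine Finset.sum_congr rfl fun r hr => ?_
  obtain ⟨s, rfl⟩ := Nat.exists_eq_add_of_le' (Finset.mem_Ico.1 hr).1
  rw [powCoeff_congr_of_lt hU hY hY' h s hx]

/-- The coefficients of the formal vector field whose exponential has the coefficients `g`. -/
noncomputable def logCoeff (g : ℕ → EuclideanSpace ℝ (Fin d) → EuclideanSpace ℝ (Fin d)) :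
    ℕ → EuclideanSpace ℝ (Fin d) → EuclideanSpace ℝ (Fin d)
  | 0 => 0
  | m + 1 => g (m + 1) - nonlinearCoeff (fun k => if _h : k < m + 1 then logCoeff g k else 0) (m + 1)

theorem contDiffOn_logCoeff (hU : IsOpen U)
    {g : ℕ → EuclideanSpace ℝ (Fin d) → EuclideanSpace ℝ (Fin d)}
    (hg : ∀ k, ContDiffOn ℝ ∞ (g k) U) (m : ℕ) : ContDiffOn ℝ ∞ (logCoeff g m) U := by
  induction m using Nat.strong_induction_on with
  | _ m ih =>
    rcases m with _ | m
    · rw [logCoeff]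
      exact contDiffOn_const
    · rw [logCoeff]
      refine (hg _).sub (contDiffOn_nonlinearCoeff hU (fun k => ?_) _)
      split_ifs with hk
      · exact ih k hk
      · exact contDiffOn_const

/-- At degree `m` the unknown enters linearly and the nonlinear part sees only lower degrees, so the
truncation that makes the recursion for `logCoeff` well founded changes nothing. -/
theorem expCoeff_logCoeff (hU : IsOpen U)
    {g : ℕ → EuclideanSpace ℝ (Fin d) → EuclideanSpace ℝ (Fin d)} {m : ℕ} (hm : 1 ≤ m) :
    Set.EqOn (expCoeff (logCoeff g) m) (g m) U := by
  intro x hx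
  obtain ⟨m, rfl⟩ := Nat.exists_eq_add_of_le' hm
  have h0 : Set.EqOn (logCoeff g 0) 0 U := fun x _ => by rw [logCoeff]
  have := nonlinearCoeff_congr hU (Y := logCoeff g)
    (Y' := fun k => if _h : k < m + 1 then logCoeff g k else 0) (m := m + 1)
    h0 (by simpa using h0) (fun k hk x _ => by simp [hk]) hx
  rw [expCoeff_eq_add hm, Pi.add_apply, this, logCoeff]
  simp

theorem powCoeff_single (f : EuclideanSpace ℝ (Fin d) → EuclideanSpace ℝ (Fin d)) (r m : ℕ) :
    powCoeff (fun k => if k = 1 then f else 0) r m = if r = m then (lieDeriv f)^[r] id else 0 := by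
  induction r generalizing m with
  | zero => simp [powCoeff, eq_comm]
  | succ r ih =>
    rw [powCoeff]
    rcases m with _ | m
    · simp [lieDeriv_zero_left]
    · rw [Finset.sum_eq_single (1, m)]
      · simp only [ih, if_true, Nat.add_right_cancel_iff]
        split_ifs
        · rw [Function.iterate_succ_apply']
        · exact lieDeriv_zero_right
      · intro i hi hne
        have hi' := Finset.HasAntidiagonal.mem_antidiagonal.1 hi
        have : i.1 ≠ 1 := fun h => hne (Prod.ext h (by simp; omega))
        simp [this, lieDeriv_zero_left]
      · intro h
        simp [add_comm] at h

/-- The nonlinear part sees only the degrees below `m`, where the field coincides with `h f`. For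
the latter only the `m`-th power contributes, which is the Lie series term of the flow. -/
theorem nonlinearCoeff_eqOn (hU : IsOpen U) {m : ℕ} (hm : 2 ≤ m) (hY0 : Set.EqOn (Y 0) 0 U)
    (hY1 : Set.EqOn (Y 1) f U) (hY : ∀ k, 2 ≤ k → k < m → Set.EqOn (Y k) 0 U) :
    Set.EqOn (nonlinearCoeff Y m) ((m.factorial : ℝ)⁻¹ • (lieDeriv f)^[m] id) U := by
  intro x hx
  rw [nonlinearCoeff_congr hU (Y' := fun k => if k = 1 then f else 0) hY0 (fun x _ => by simp) _ hx]
  · rw [nonlinearCoeff, Finset.sum_eq_single m]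
    · simp [powCoeff_single]
    · intro r _ hr
      simp [powCoeff_single, hr]
    · intro h
      simp at h
      omega
  · intro k hk y hy
    rcases k with _ | _ | k
    · simpa using hY0 hy
    · simpa using hY1 hy
    · simpa using hY (k + 2) (by omega) hk hy

theorem expCoeff_eqOn (hU : IsOpen U) {m : ℕ} (hm : 2 ≤ m) (hY0 : Set.EqOn (Y 0) 0 U)
    (hY1 : Set.EqOn (Y 1) f U) (hY : ∀ k, 2 ≤ k → k < m → Set.EqOn (Y k) 0 U) :
    Set.EqOn (expCoeff Y m) (Y m + (m.factorial : ℝ)⁻¹ • (lieDeriv f)^[m] id) U := fun x hx => by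
  rw [expCoeff_eq_add (by omega), Pi.add_apply, nonlinearCoeff_eqOn hU hm hY0 hY1 hY hx,
    Pi.add_apply]

theorem expCoeff_one (hY1 : Set.EqOn (Y 1) f U) : Set.EqOn (expCoeff Y 1) f U := fun x hx => by
  rw [expCoeff_eq_add le_rfl]
  simpa [nonlinearCoeff] using hY1 hx

variable {K : ℕ∞} {Φ : ℝ → EuclideanSpace ℝ (Fin d) → EuclideanSpace ℝ (Fin d)} {p : ℕ}
  {e : EuclideanSpace ℝ (Fin d) → EuclideanSpace ℝ (Fin d)}

theorem HasExpForm.contDiffOn (h : HasExpForm U K Φ f p e) : ContDiffOn ℝ ∞ e U := by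
  obtain ⟨Y, hY, -, -, -, he, -⟩ := h
  exact (hY (p + 1)).congr fun x hx => (he hx).symm

theorem HasExpForm.hasSmoothApprox (hU : IsOpen U) (h : HasExpForm U K Φ f p e) {n : ℕ}
    (hn : (n : ℕ∞) ≤ (p : ℕ∞) + 1 + K) : HasSmoothApprox U n Φ := by
  obtain ⟨Y, hY, -, -, -, -, hexp⟩ := h
  exact hasSmoothApprox_of_coeff hU (contDiffOn_expCoeff hU hY)
    (fun x _ => by simp [expCoeff_zero]) (hexp n hn)

theorem sum_exp_add_error {x : EuclideanSpace ℝ (Fin d)} (t : ℝ) :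
    ∑ m ∈ Finset.range (p + 1 + 1), t ^ m • ((m.factorial : ℝ)⁻¹ • ((lieDeriv f)^[m] id) x
        + if m = p + 1 then e x else 0)
      = ∑ m ∈ Finset.range (p + 1 + 1), t ^ m • ((m.factorial : ℝ)⁻¹ • (lieDeriv f)^[m] id) x
        + t ^ (p + 1) • e x := by
  simp only [smul_add, Finset.sum_add_distrib, smul_ite, smul_zero, Pi.smul_apply]
  simp

/-- Through degree `p + 1` the two expansions differ only by the linear contribution of `Y (p + 1)`.
As `p ≥ 1`, that degree does not collide with the one of `f`. -/
theorem HasExpForm.hasDefect (hU : IsOpen U) (hf : ContDiffOn ℝ ∞ f U) (hp : 1 ≤ p)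
    (h : HasExpForm U K Φ f p e) : HasDefect U (p + 1) Φ (exactFlow U f) e := by
  obtain ⟨Y, -, hY0, hY1, hYk, he, hexp⟩ := h
  intro x hx
  have h1 := hexp (p + 1) (by push_cast; exact le_self_add) x hx
  have h2 := exactFlow_expansion hU hf hx (p + 1 + 1)
  refine (h1.sub h2).congr' ?_ EventuallyEq.rfl
  have hUn : ∀ᶠ q : ℝ × EuclideanSpace ℝ (Fin d) in 𝓝 ((0 : ℝ), x), q.2 ∈ U :=
    continuousAt_snd.eventually_mem (hU.mem_nhds hx)
  filter_upwards [hUn] with q hq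
  have key : ∑ m ∈ Finset.range (p + 1 + 1), q.1 ^ m • expCoeff Y m q.2
      = ∑ m ∈ Finset.range (p + 1 + 1), q.1 ^ m • ((m.factorial : ℝ)⁻¹ • ((lieDeriv f)^[m] id) q.2
        + if m = p + 1 then e q.2 else 0) := by
    refine Finset.sum_congr rfl fun m hm => ?_
    congr 1
    have hm' := Finset.mem_range.1 hm
    rcases m with _ | _ | m
    · simp [expCoeff_zero]
    · simp [expCoeff_one hY1 hq, show p ≠ 0 by omega, lieDeriv_id_right]
    · rw [expCoeff_eqOn hU (by omega) hY0 hY1 (fun k hk hk' => hYk k hk (by omega)) hq,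
        Pi.add_apply, add_comm]
      split_ifs with hmp
      · rw [hmp, he hq]
        rfl
      · rw [hYk _ (by omega) (by omega) hq]
        rfl
  rw [key, sum_exp_add_error]
  abel

theorem hasExpForm_of_hasDefect (hU : IsOpen U) (hf : ContDiffOn ℝ ∞ f U) (hp : 1 ≤ p)
    (hd : HasDefect U (p + 1) Φ (exactFlow U f) e)
    (hs : ∀ n : ℕ, (n : ℕ∞) ≤ (p : ℕ∞) + 1 + K → HasSmoothApprox U n Φ) :
    HasExpForm U K Φ f p e := by
  obtain ⟨g, hg, hg0, hexp⟩ := exists_coeff_of_forall_hasSmoothApprox hU hs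
  -- Uniqueness of coefficients: the defect fixes the expansion through degree `p + 1`, while higher
  -- coefficients stay arbitrary.
  have hgm : ∀ x ∈ U, ∀ m < p + 1 + 1, g m x = (m.factorial : ℝ)⁻¹ • ((lieDeriv f)^[m] id) x
        + if m = p + 1 then e x else 0 := fun x hx => by
    refine coeff_unique (Φ := Φ) (g' := fun m x => (m.factorial : ℝ)⁻¹ • ((lieDeriv f)^[m] id) x
        + if m = p + 1 then e x else 0) (hexp (p + 1) (by push_cast; exact le_self_add) x hx) ?_
    simp only [sum_exp_add_error]
    refine ((hd x hx).add (exactFlow_expansion hU hf hx (p + 1 + 1))).congr_left fun q => ?_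
    abel
  have hE : ∀ m, 1 ≤ m → Set.EqOn (expCoeff (logCoeff g) m) (g m) U :=
    fun m hm => expCoeff_logCoeff hU hm
  have h0 : Set.EqOn (logCoeff g 0) 0 U := fun x _ => by rw [logCoeff]
  have h1 : Set.EqOn (logCoeff g 1) f U := fun x hx => by
    rw [← expCoeff_one (Y := logCoeff g) (fun _ _ => rfl) hx, hE 1 le_rfl hx, hgm x hx 1 (by omega)]
    simp [show p ≠ 0 by omega, lieDeriv_id_right]
  -- Once the lower degrees vanish, the coefficient of degree `k` is that of the flow plus `logCoeff
  -- g k`, and it equals that of the flow.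
  have hk : ∀ k, 2 ≤ k → k ≤ p → Set.EqOn (logCoeff g k) 0 U := fun k => by
    induction k using Nat.strong_induction_on with
    | _ k ih =>
      intro hk2 hkp x hx
      have a := expCoeff_eqOn hU hk2 h0 h1 (fun j hj hj' => ih j hj' hj (by omega)) hx
      rw [hE k (by omega) hx, hgm x hx k (by omega), if_neg (by omega), add_zero] at a
      simpa using a
  refine ⟨logCoeff g, contDiffOn_logCoeff hU hg, h0, h1, hk, fun x hx => ?_, fun n hn x hx => ?_⟩
  · have a := expCoeff_eqOn hU (show 2 ≤ p + 1 by omega) h0 h1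
      (fun j hj hj' => hk j hj (by omega)) hx
    rw [hE _ (by omega) hx, hgm x hx _ (by omega), if_pos rfl, Pi.add_apply, add_comm] at a
    exact (add_right_cancel a).symm
  · refine (hexp n hn x hx).congr' ?_ EventuallyEq.rfl
    have hUn : ∀ᶠ q : ℝ × EuclideanSpace ℝ (Fin d) in 𝓝 ((0 : ℝ), x), q.2 ∈ U :=
      continuousAt_snd.eventually_mem (hU.mem_nhds hx)
    filter_upwards [hUn] with q hq
    congr 1
    refine Finset.sum_congr rfl fun m _ => ?_
    rcases Nat.eq_zero_or_pos m with rfl | hm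
    · rw [expCoeff_zero, hg0 _ hq, id]
    · rw [hE m hm hq]

end LieSeries

/-! ### Containment of nodes recovers the tree structure -/

namespace SplittingTree

variable {N : ℕ} (G : SplittingTree N) {u v w x : Finset (Fin N)}

theorem mem_innerNodes : v ∈ G.innerNodes ↔ v ∈ G.nodes ∧ 1 < v.card := Finset.mem_filter

theorem left_subset (hv : v ∈ G.innerNodes) : G.left v ⊆ v := by
  obtain ⟨h1, h2⟩ := G.mem_innerNodes.1 hv
  conv_rhs => rw [← G.union_children v h1 h2]
  exact Finset.subset_union_left

theorem right_subset (hv : v ∈ G.innerNodes) : G.right v ⊆ v := by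
  obtain ⟨h1, h2⟩ := G.mem_innerNodes.1 hv
  conv_rhs => rw [← G.union_children v h1 h2]
  exact Finset.subset_union_right

theorem not_subset_of_disjoint (hu : u ∈ G.nodes) (huw : u ⊆ w) (h : Disjoint w x) : ¬ u ⊆ x :=
  fun hux => by
    obtain ⟨a, ha⟩ := G.nonempty u hu
    exact Finset.disjoint_left.1 h (huw ha) (hux ha)

/-- A node is contained in a child of an inner node `x` unless it contains `x` or is disjoint from
`x`. -/
theorem subset_or_disjoint (hw : w ∈ G.nodes) (hx : x ∈ G.innerNodes) :
    x ⊆ w ∨ w ⊆ G.left x ∨ w ⊆ G.right x ∨ Disjoint x w := by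
  induction h : (N - w.card) + (N - x.card) using Nat.strong_induction_on generalizing w x with
  | _ n ih =>
    by_cases hwu : w = Finset.univ
    · exact Or.inl (hwu ▸ Finset.subset_univ x)
    obtain ⟨y, hy, hy1, hwy⟩ := G.exists_parent w hw hwu
    have hyi : y ∈ G.innerNodes := G.mem_innerNodes.2 ⟨hy, hy1⟩
    have hwy' : w ⊆ y := by
      rcases hwy with rfl | rfl
      exacts [G.left_subset hyi, G.right_subset hyi]
    have hcard : w.card < y.card := by
      rcases hwy with rfl | rfl
      exacts [G.left_card_lt hyi, G.right_card_lt hyi]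
    have hyN : y.card ≤ N := by simpa using Finset.card_le_univ y
    -- The node `w` is replaced by its parent `y`, which lowers the measure. Only `x ⊆ y` needs more
    -- work.
    rcases ih _ (by omega) hy hx rfl with h1 | h1 | h1 | h1
    · by_cases hxy : x = y
      · subst hxy
        rcases hwy with rfl | rfl
        · exact Or.inr (Or.inl subset_rfl)
        · exact Or.inr (Or.inr (Or.inl subset_rfl))
      have hd := G.disjoint_children y hy hy1
      -- The roles are exchanged: `x` is compared with the inner node `y`, again of smaller measure
      -- because `y` is larger than `w`.
      rcases ih _ (by omega) (G.mem_innerNodes.1 hx).1 hyi rfl with h2 | h2 | h2 | h2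
      · exact absurd (h1.antisymm h2) hxy
      · rcases hwy with rfl | rfl
        · exact Or.inl h2
        · exact Or.inr (Or.inr (Or.inr (hd.mono_left h2)))
      · rcases hwy with rfl | rfl
        · exact Or.inr (Or.inr (Or.inr (hd.symm.mono_left h2)))
        · exact Or.inl h2
      · exact absurd subset_rfl (G.not_subset_of_disjoint (G.mem_innerNodes.1 hx).1 h1 h2)
    · exact Or.inr (Or.inl (hwy'.trans h1))
    · exact Or.inr (Or.inr (Or.inl (hwy'.trans h1)))
    · exact Or.inr (Or.inr (Or.inr (h1.mono_right hwy')))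

theorem subset_child (hw : w ∈ G.nodes) (hv : v ∈ G.innerNodes) (hwv : w ⊆ v) (hne : w ≠ v) :
    w ⊆ G.left v ∨ w ⊆ G.right v := by
  rcases G.subset_or_disjoint hw hv with h | h | h | h
  · exact absurd (hwv.antisymm h) hne
  · exact Or.inl h
  · exact Or.inr h
  · exact absurd subset_rfl (G.not_subset_of_disjoint hw hwv h)

theorem child_mem (hv : v ∈ G.innerNodes) (hu : u = G.left v ∨ u = G.right v) : u ∈ G.nodes := by
  obtain ⟨h1, h2⟩ := G.mem_innerNodes.1 hv
  rcases hu with rfl | rfl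
  exacts [G.left_mem v h1 h2, G.right_mem v h1 h2]

theorem child_ssubset (hv : v ∈ G.innerNodes) (hu : u = G.left v ∨ u = G.right v) : u ⊂ v := by
  rcases hu with rfl | rfl
  · exact (G.left_subset hv).ssubset_of_ne fun h => (G.left_card_lt hv).ne (by rw [h])
  · exact (G.right_subset hv).ssubset_of_ne fun h => (G.right_card_lt hv).ne (by rw [h])

theorem mem_path : w ∈ G.path v ↔ w ∈ G.nodes ∧ v ⊂ w := Finset.mem_filter

theorem self_notMem_path : v ∉ G.path v := fun h => (G.mem_path.1 h).2.ne rfl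

theorem path_univ : G.path Finset.univ = ∅ :=
  Finset.eq_empty_of_forall_notMem fun w h =>
    (G.mem_path.1 h).2.not_subset (Finset.subset_univ w)

theorem path_subset_of_mem (hu : u ∈ G.path v) : G.path u ⊆ G.path v := fun _ hw =>
  G.mem_path.2 ⟨(G.mem_path.1 hw).1, (G.mem_path.1 hu).2.trans (G.mem_path.1 hw).2⟩

/-- This justifies defining paths by strict containment: no node containing a child can avoid
containing the parent, except the child itself. -/
theorem path_child (hv : v ∈ G.innerNodes) (hu : u = G.left v ∨ u = G.right v) :
    G.path u = G.pathBar v := by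
  obtain ⟨h1, h2⟩ := G.mem_innerNodes.1 hv
  have huv := G.child_ssubset hv hu
  have hd := G.disjoint_children v h1 h2
  ext w
  rw [pathBar, Finset.mem_insert, mem_path, mem_path]
  constructor
  · rintro ⟨hw, huw⟩
    rcases G.subset_or_disjoint hw hv with h | h | h | h
    · rcases h.eq_or_ssubset with h | h
      exacts [Or.inl h.symm, Or.inr ⟨hw, h⟩]
    · rcases hu with rfl | rfl
      · exact absurd h huw.not_subset
      · exact absurd (huw.subset.trans h)
          (G.not_subset_of_disjoint (G.right_mem v h1 h2) subset_rfl hd.symm)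
    · rcases hu with rfl | rfl
      · exact absurd (huw.subset.trans h)
          (G.not_subset_of_disjoint (G.left_mem v h1 h2) subset_rfl hd)
      · exact absurd h huw.not_subset
    · exact absurd huw.subset (G.not_subset_of_disjoint (G.child_mem hv hu) huv.subset h)
  · rintro (rfl | ⟨hw, hvw⟩)
    · exact ⟨h1, huv⟩
    · exact ⟨hw, huv.trans hvw⟩

theorem mem_innerNodes_of_mem_path (hv : v ∈ G.nodes) (hw : w ∈ G.path v) : w ∈ G.innerNodes := by
  obtain ⟨h1, h2⟩ := G.mem_path.1 hw
  have := Finset.card_lt_card h2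
  have := (G.nonempty v hv).card_pos
  exact G.mem_innerNodes.2 ⟨h1, by omega⟩

theorem left_mem_pathBar_child (hv : v ∈ G.innerNodes) (hu : u = G.left v ∨ u = G.right v)
    (hw : w ∈ G.path v) : G.left w ∈ G.pathBar u ↔ G.left w ∈ G.pathBar v := by
  have hvn := (G.mem_innerNodes.1 hv).1
  have hwi := G.mem_innerNodes_of_mem_path hvn hw
  obtain ⟨h1, h2⟩ := G.mem_innerNodes.1 hwi
  have huv := G.child_ssubset hv hu
  have hvw := (G.mem_path.1 hw).2
  have hne : G.left w ≠ u := by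
    rintro rfl
    rcases G.subset_child hvn hwi hvw.subset hvw.ne with h | h
    · exact huv.not_subset h
    · exact G.not_subset_of_disjoint (G.left_mem w h1 h2) subset_rfl
        (G.disjoint_children w h1 h2) (huv.subset.trans h)
  rw [pathBar, G.path_child hv hu, Finset.mem_insert, or_iff_right hne]

theorem notMem_innerNodes (hv : v ∈ G.nodes) (h : v ∉ G.innerNodes) : v.card = 1 := by
  have h1 : ¬ 1 < v.card := fun h' => h (G.mem_innerNodes.2 ⟨hv, h'⟩)
  have := (G.nonempty v hv).card_pos
  omega

end SplittingTree

/-! ### Unrolling the recursive error into index tuples -/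

namespace MultirateHSM

variable {d N : ℕ} (S : MultirateHSM d N) {u v w : Finset (Fin N)} {j j' : Finset (Fin N) → ℕ}

theorem active_subset_nodes (hv : v ∈ S.active) : v ∈ S.nodes := by
  rcases Finset.mem_union.1 hv with h | h
  · exact (S.mem_innerNodes.1 h).1
  · exact (Finset.mem_filter.1 (S.approx_subset h)).1

theorem pathCoeff_child (hv : v ∈ S.innerNodes) (hu : u = S.left v ∨ u = S.right v)
    (hw : w ∈ S.path v) (i : ℕ) : S.pathCoeff u w i = S.pathCoeff v w i := by
  simp only [pathCoeff, S.left_mem_pathBar_child hv hu hw]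

theorem pathCoeff_left (v : Finset (Fin N)) (i : ℕ) : S.pathCoeff (S.left v) v i = S.a v i := by
  simp [pathCoeff, SplittingTree.pathBar]

theorem pathCoeff_right (hv : v ∈ S.innerNodes) (i : ℕ) :
    S.pathCoeff (S.right v) v i = S.b v i := by
  obtain ⟨h1, h2⟩ := S.mem_innerNodes.1 hv
  have hns : ¬ S.right v ⊆ S.left v :=
    S.not_subset_of_disjoint (S.right_mem v h1 h2) subset_rfl (S.disjoint_children v h1 h2).symm
  refine if_neg fun h => ?_
  rcases Finset.mem_insert.1 h with h | h
  · exact hns h.ge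
  · exact hns (S.mem_path.1 h).2.subset

theorem coeffProd_child (hv : v ∈ S.innerNodes) (hu : u = S.left v ∨ u = S.right v) :
    S.coeffProd u j = S.pathCoeff u v (j v) * S.coeffProd v j := by
  rw [coeffProd, S.path_child hv hu, SplittingTree.pathBar,
    Finset.prod_insert S.self_notMem_path]
  congr 1
  exact Finset.prod_congr rfl fun w hw => S.pathCoeff_child hv hu hw _

theorem coeffProd_congr (h : ∀ w ∈ S.path v, j w = j' w) : S.coeffProd v j = S.coeffProd v j' :=
  Finset.prod_congr rfl fun w hw => by rw [h w hw]

theorem mrFactor_congr (h : ∀ w ∈ S.path v, j w = j' w) : S.mrFactor j v = S.mrFactor j' v := by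
  induction hn : N - v.card using Nat.strong_induction_on generalizing v with
  | _ n ih =>
    rw [mrFactor_eq, mrFactor_eq, stepCoeff, stepCoeff, S.coeffProd_congr h]
    have key : ∀ u ∈ (S.path v).erase Finset.univ, (S.mrFactor j u : ℝ) = S.mrFactor j' u := by
      intro u hu
      have hu' := Finset.mem_of_mem_erase hu
      have h1 := Finset.card_lt_card (S.mem_path.1 hu').2
      have h2 := Finset.card_le_univ u
      rw [Fintype.card_fin] at h2
      rw [ih _ (by omega) (fun w hw => h w (S.path_subset_of_mem hu' hw)) rfl]
    rw [Finset.prod_congr rfl key]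

/-- The number of repetitions of the occurrence of `v` given by the indices `j`. -/
noncomputable def mrProd (j : Finset (Fin N) → ℕ) (v : Finset (Fin N)) : ℝ :=
  ∏ u ∈ (S.path v).erase Finset.univ, (S.mrFactor j u : ℝ)

theorem mrProd_congr (h : ∀ w ∈ S.path v, j w = j' w) : S.mrProd j v = S.mrProd j' v :=
  Finset.prod_congr rfl fun u hu => by
    rw [S.mrFactor_congr fun w hw =>
      h w (S.path_subset_of_mem (Finset.mem_of_mem_erase hu) hw)]

theorem stepCoeff_congr (h : ∀ w ∈ S.path v, j w = j' w) : S.stepCoeff j v = S.stepCoeff j' v := by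
  have h1 := S.mrProd_congr h
  unfold mrProd at h1
  rw [stepCoeff, stepCoeff, S.coeffProd_congr h, h1]

/-- The root is erased on the left and has `subSteps` equal to `1` on the right, so the formula
holds there as well. -/
theorem prod_pathBar (j : Finset (Fin N) → ℕ) (v : Finset (Fin N)) :
    ∏ w ∈ (S.pathBar v).erase Finset.univ, (S.mrFactor j w : ℝ)
      = S.subSteps v (S.stepCoeff j v) * S.mrProd j v := by
  rw [SplittingTree.pathBar, subSteps, mrProd]
  split_ifs with hv
  · simp [hv, S.path_univ]
  · rw [Finset.erase_insert_of_ne hv, Finset.prod_insert, mrFactor_eq]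
    exact fun h => S.self_notMem_path (Finset.mem_of_mem_erase h)

theorem mrProd_child (hv : v ∈ S.innerNodes) (hu : u = S.left v ∨ u = S.right v) :
    S.mrProd j u = S.subSteps v (S.stepCoeff j v) * S.mrProd j v := by
  rw [← prod_pathBar, mrProd, S.path_child hv hu]

/-- The closed formula obeys the recursion by which `step` passes `c` to the children. It also holds
for vanishing factors, by the convention for division by zero. -/
theorem stepCoeff_child (hv : v ∈ S.innerNodes) (hu : u = S.left v ∨ u = S.right v) :
    S.stepCoeff j u
      = S.pathCoeff u v (j v) * S.stepCoeff j v / S.subSteps v (S.stepCoeff j v) := by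
  have h1 := S.mrProd_child (j := j) hv hu
  rw [mrProd] at h1
  rw [stepCoeff, h1, S.coeffProd_child hv hu]
  conv_rhs => enter [1, 2]; rw [stepCoeff]
  rw [mrProd]
  ring

theorem mem_indexTuples :
    j ∈ S.indexTuples v ↔ ∀ w, j w ∈ if w ∈ S.path v then Finset.Icc 1 (S.s w) else {0} :=
  Fintype.mem_piFinset

/-- A tuple for a child is a tuple for `v` together with a stage index at `v`; since tuples are `0`
off the path, the inverse resets that entry to `0`. -/
theorem sum_indexTuples_child {M : Type*} [AddCommMonoid M] (hv : v ∈ S.innerNodes)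
    (hu : u = S.left v ∨ u = S.right v) (F : (Finset (Fin N) → ℕ) → M) :
    ∑ j ∈ S.indexTuples u, F j
      = ∑ j ∈ S.indexTuples v, ∑ i ∈ Finset.Icc 1 (S.s v), F (Function.update j v i) := by
  rw [← Finset.sum_product']
  refine Finset.sum_bij' (fun j _ => (Function.update j v 0, j v))
    (fun q _ => Function.update q.1 v q.2) ?_ ?_ ?_ ?_ ?_
  · intro j hj
    rw [mem_indexTuples, S.path_child hv hu, SplittingTree.pathBar] at hj
    rw [Finset.mem_product, mem_indexTuples]
    refine ⟨fun w => ?_, by simpa using hj v⟩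
    rcases eq_or_ne w v with rfl | hw
    · simp [S.self_notMem_path]
    · simpa [hw] using hj w
  · rintro ⟨j, i⟩ hj
    rw [Finset.mem_product, mem_indexTuples] at hj
    rw [mem_indexTuples, S.path_child hv hu, SplittingTree.pathBar]
    intro w
    rcases eq_or_ne w v with rfl | hw
    · simpa using hj.2
    · simpa [hw] using hj.1 w
  · intro j _
    simp
  · rintro ⟨j, i⟩ hj
    rw [Finset.mem_product, mem_indexTuples] at hj
    have h0 : j v = 0 := by simpa [S.self_notMem_path] using hj.1 v
    simp [← h0]
  · intro j _
    simp

variable {V : Type*} [AddCommGroup V] [Module ℝ V]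

/-- The error accumulated while node `v` is advanced by `c * h`, as a combination of the leading
errors `e w` of order `p + 1` of the schemes at `v` and its descendants `w`. -/
noncomputable def accError (e : Finset (Fin N) → V) (p : ℕ) (v : Finset (Fin N)) (c : ℝ) : V :=
  if hv : v ∈ S.innerNodes then
    (S.subSteps v c : ℝ) • ((c / S.subSteps v c) ^ (p + 1) • e v
      + ∑ j ∈ Finset.Icc 1 (S.s v), (accError e p (S.left v) (S.a v j * c / S.subSteps v c)
        + accError e p (S.right v) (S.b v j * c / S.subSteps v c)))
  else if v ∈ S.approx then (S.subSteps v c : ℝ) • ((c / S.subSteps v c) ^ (p + 1) • e v)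
  else 0
termination_by v.card
decreasing_by
  · exact S.left_card_lt hv
  · exact S.right_card_lt hv

/-- The coefficient of the leading error of node `v` in the error of the overall method. -/
noncomputable def errorWeight (p : ℕ) (v : Finset (Fin N)) : ℝ :=
  ∑ j ∈ S.indexTuples v, (S.coeffProd v j) ^ (p + 1) /
    (∏ w ∈ (S.pathBar v).erase Finset.univ, (S.mrFactor j w : ℝ)) ^ p

/-- With `X` the number of sub-steps including repetitions, this is `A ^ (p + 1) / X ^ p = X * (A /
X) ^ (p + 1)`. For `X = 0` both sides vanish, the left one because `p ≥ 1`. -/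
theorem errorWeight_eq {p : ℕ} (hp : 1 ≤ p) (v : Finset (Fin N)) :
    S.errorWeight p v = ∑ j ∈ S.indexTuples v, S.mrProd j v * (S.subSteps v (S.stepCoeff j v)
      * (S.stepCoeff j v / S.subSteps v (S.stepCoeff j v)) ^ (p + 1)) := by
  refine Finset.sum_congr rfl fun j _ => ?_
  rw [prod_pathBar]
  have h : S.stepCoeff j v / S.subSteps v (S.stepCoeff j v)
      = S.coeffProd v j / (S.subSteps v (S.stepCoeff j v) * S.mrProd j v) := by
    conv_lhs => enter [1]; rw [stepCoeff]
    rw [mrProd, div_div, mul_comm]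
  rw [h, ← mul_assoc, mul_comm (S.mrProd j v)]
  generalize (S.subSteps v (S.stepCoeff j v) : ℝ) * S.mrProd j v = X
  rcases eq_or_ne X 0 with rfl | hX
  · simp [show p ≠ 0 by omega]
  · rw [div_pow, pow_succ X]
    field_simp

theorem sum_accError_child (hv : v ∈ S.innerNodes) (hu : u = S.left v ∨ u = S.right v)
    (e : Finset (Fin N) → V) (p : ℕ) :
    ∑ j ∈ S.indexTuples u, S.mrProd j u • S.accError e p u (S.stepCoeff j u)
      = ∑ j ∈ S.indexTuples v, S.mrProd j v • ((S.subSteps v (S.stepCoeff j v) : ℝ) •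
        ∑ i ∈ Finset.Icc 1 (S.s v), S.accError e p u
          (S.pathCoeff u v i * S.stepCoeff j v / S.subSteps v (S.stepCoeff j v))) := by
  rw [S.sum_indexTuples_child hv hu]
  refine Finset.sum_congr rfl fun j _ => ?_
  rw [Finset.smul_sum, Finset.smul_sum]
  refine Finset.sum_congr rfl fun i _ => ?_
  have hj : ∀ w ∈ S.path v, Function.update j v i w = j w := fun w hw =>
    Function.update_of_ne (fun h => S.self_notMem_path (h ▸ hw)) _ _
  rw [S.mrProd_child hv hu, S.stepCoeff_child hv hu, S.mrProd_congr hj, S.stepCoeff_congr hj,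
    Function.update_self, smul_smul, mul_comm]

/-- The factor `mrProd` counts how often an occurrence of `v` is repeated. The active nodes below an
inner `v` are `v` itself and those below exactly one child, so induction on the size of `v` sums up
the contributions. -/
theorem sum_accError (e : Finset (Fin N) → V) {p : ℕ} (hp : 1 ≤ p) (hv : v ∈ S.nodes) :
    ∑ j ∈ S.indexTuples v, S.mrProd j v • S.accError e p v (S.stepCoeff j v)
      = ∑ w ∈ S.active with w ⊆ v, S.errorWeight p w • e w := by
  induction hn : v.card using Nat.strong_induction_on generalizing v with
  | _ n ih =>
    by_cases hvi : v ∈ S.innerNodes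
    · obtain ⟨h1, h2⟩ := S.mem_innerNodes.1 hvi
      have hl := ih _ (hn ▸ S.left_card_lt hvi) (S.left_mem v h1 h2) rfl
      have hr := ih _ (hn ▸ S.right_card_lt hvi) (S.right_mem v h1 h2) rfl
      have hd := S.disjoint_children v h1 h2
      have hset : S.active.filter (· ⊆ v) = insert v (S.active.filter (· ⊆ S.left v)
          ∪ S.active.filter (· ⊆ S.right v)) := by
        ext w
        simp only [Finset.mem_filter, Finset.mem_insert, Finset.mem_union]
        constructor
        · rintro ⟨hw, hwv⟩
          rcases eq_or_ne w v with rfl | hne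
          · exact Or.inl rfl
          · rcases S.subset_child (S.active_subset_nodes hw) hvi hwv hne with h | h
            · exact Or.inr (Or.inl ⟨hw, h⟩)
            · exact Or.inr (Or.inr ⟨hw, h⟩)
        · rintro (rfl | ⟨hw, h⟩ | ⟨hw, h⟩)
          · exact ⟨Finset.mem_union_left _ hvi, subset_rfl⟩
          · exact ⟨hw, h.trans (S.left_subset hvi)⟩
          · exact ⟨hw, h.trans (S.right_subset hvi)⟩
      rw [hset, Finset.sum_insert, Finset.sum_union, ← hl, ← hr,
        S.sum_accError_child hvi (Or.inl rfl), S.sum_accError_child hvi (Or.inr rfl),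
        S.errorWeight_eq hp, Finset.sum_smul, ← Finset.sum_add_distrib, ← Finset.sum_add_distrib]
      · refine Finset.sum_congr rfl fun j _ => ?_
        rw [accError, dif_pos hvi]
        simp only [S.pathCoeff_left, S.pathCoeff_right hvi, Finset.sum_add_distrib, smul_add,
          smul_smul]
      · rw [Finset.disjoint_left]
        intro w hw hw'
        exact S.not_subset_of_disjoint (S.active_subset_nodes (Finset.mem_filter.1 hw).1)
          (Finset.mem_filter.1 hw).2 hd (Finset.mem_filter.1 hw').2
      · simp only [Finset.mem_union, Finset.mem_filter, not_or, not_and]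
        exact ⟨fun _ => (S.child_ssubset hvi (Or.inl rfl)).not_subset,
          fun _ => (S.child_ssubset hvi (Or.inr rfl)).not_subset⟩
    · have hc := S.notMem_innerNodes hv hvi
      have heq : ∀ w ∈ S.active, w ⊆ v → w = v := fun w hw hwv =>
        Finset.eq_of_subset_of_card_le hwv (by
          have := (S.nonempty w (S.active_subset_nodes hw)).card_pos
          omega)
      by_cases hva : v ∈ S.approx
      · have hset : S.active.filter (· ⊆ v) = {v} := by
          ext w
          simp only [Finset.mem_filter, Finset.mem_singleton]
          refine ⟨fun h => heq w h.1 h.2, ?_⟩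
          rintro rfl
          exact ⟨Finset.mem_union_right _ hva, subset_rfl⟩
        rw [hset, Finset.sum_singleton, S.errorWeight_eq hp, Finset.sum_smul]
        refine Finset.sum_congr rfl fun j _ => ?_
        rw [accError, dif_neg hvi, if_pos hva]
        simp only [smul_smul]
      · have hset : S.active.filter (· ⊆ v) = ∅ := by
          refine Finset.filter_eq_empty_iff.2 fun w hw hwv => ?_
          rw [heq w hw hwv] at hw
          rcases Finset.mem_union.1 hw with h | h
          exacts [hvi h, hva h]
        rw [hset, Finset.sum_empty]
        refine Finset.sum_eq_zero fun j _ => ?_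
        rw [accError, dif_neg hvi, if_neg hva, smul_zero]

theorem accError_univ (e : Finset (Fin N) → V) {p : ℕ} (hp : 1 ≤ p) :
    S.accError e p Finset.univ 1 = ∑ w ∈ S.active, S.errorWeight p w • e w := by
  have h := S.sum_accError e hp S.root_mem
  have h1 : ∀ j, S.mrProd j Finset.univ = 1 := fun j => by simp [mrProd, S.path_univ]
  have h2 : ∀ j, S.stepCoeff j Finset.univ = 1 := fun j => by
    simp [stepCoeff, coeffProd, S.path_univ]
  simp only [h1, h2, one_smul, Finset.sum_const] at h
  have h3 : (S.indexTuples Finset.univ).card = 1 := by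
    simp [indexTuples, S.path_univ]
  rw [h3, one_smul] at h
  rw [h]
  exact Finset.sum_congr (by simp) fun _ _ => rfl

end MultirateHSM

/-- Nodes of order above the minimum contribute nothing to the leading error. -/
theorem HasDefect.of_lt {E : Type*} [NormedAddCommGroup E] [NormedSpace ℝ E] {U : Set E}
    (hU : IsOpen U) {k k' : ℕ} (hk : k < k') {Φ Ψ : ℝ → E → E} {e : E → E}
    (h : HasDefect U k' Φ Ψ e) (he : ContDiffOn ℝ ∞ e U) : HasDefect U k Φ Ψ 0 := fun x hx => by
  have hc : ContinuousAt (fun q : ℝ × E => e q.2) (0, x) :=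
    ContinuousAt.comp (g := e) (f := Prod.snd) (x := ((0 : ℝ), x))
      (he.continuousOn.continuousAt (hU.mem_nhds hx)) continuousAt_snd
  have h1 := (fst_pow_isBigO (Nat.succ_le_of_lt hk) x).smul (hc.isBigO_one ℝ)
  have h2 := ((h x hx).trans (fst_pow_isBigO (show k + 1 ≤ k' + 1 by omega) x)).add
    (by simpa using h1)
  simpa using h2

/-! ### The defect of the recursive step -/

namespace MultirateHSM

variable {d N : ℕ} (S : MultirateHSM d N) {U : Set (EuclideanSpace ℝ (Fin d))}
  {f : Fin N → EuclideanSpace ℝ (Fin d) → EuclideanSpace ℝ (Fin d)} {v : Finset (Fin N)}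

theorem contDiffOn_rhs (hf : ∀ m, ContDiffOn ℝ ∞ (f m) U) (v : Finset (Fin N)) :
    ContDiffOn ℝ ∞ (rhs f v) U :=
  ContDiffOn.sum fun m _ => hf m

theorem notMem_innerNodes_of_mem_approx (hv : v ∈ S.approx) : v ∉ S.innerNodes := fun h => by
  have h1 := (Finset.mem_filter.1 (S.approx_subset hv)).2
  have h2 := (S.mem_innerNodes.1 h).2
  omega

theorem nodeMethod_of_mem_approx (hv : v ∈ S.approx) : S.nodeMethod U f v = S.Ψ v := by
  ext1 h
  rw [nodeMethod, if_neg (S.notMem_innerNodes_of_mem_approx hv)]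

/-- Positivity of the multirate factors guarantees that zero sub-steps occur only for `c = 0`, so
the sub-steps always cover the whole step. -/
theorem subSteps_mul_div (hv : v ∈ S.nodes) (c : ℝ) :
    (S.subSteps v c : ℝ) * (c / S.subSteps v c) = c := by
  by_cases h : S.subSteps v c = 0
  · have hc : c = 0 := by
      rw [subSteps] at h
      split_ifs at h with hu
      have h1 := Nat.ceil_eq_zero.1 h
      have h2 : (0 : ℝ) < S.M v := by exact_mod_cast S.M_pos v hv hu
      have h3 : |c| ≤ 0 := nonpos_of_mul_nonpos_left h1 h2
      exact abs_nonpos_iff.1 h3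
    simp [hc]
  · have : (S.subSteps v c : ℝ) ≠ 0 := by exact_mod_cast h
    field_simp

theorem hasSmoothApprox_step (hU : IsOpen U) (hf : ∀ m, ContDiffOn ℝ ∞ (f m) U) {n : ℕ}
    (hΨ : ∀ v ∈ S.approx, HasSmoothApprox U n (S.Ψ v)) (v : Finset (Fin N)) (c : ℝ) :
    HasSmoothApprox U n (S.step U f v c) := by
  induction hn : v.card using Nat.strong_induction_on generalizing v c with
  | _ k ih =>
    by_cases hv : v ∈ S.innerNodes
    · have h1 := fun c => ih _ (hn ▸ S.left_card_lt hv) (S.left v) c rfl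
      have h2 := fun c => ih _ (hn ▸ S.right_card_lt hv) (S.right v) c rfl
      have h3 := (HasSmoothApprox.altComp
        (A := fun j => S.step U f (S.left v) (S.a v j * c / S.subSteps v c))
        (B := fun j => S.step U f (S.right v) (S.b v j * c / S.subSteps v c))
        (fun j => h1 _) (fun j => h2 _) (S.s v)).iterate (S.subSteps v c)
      convert h3 using 2 with t
      rw [step, dif_pos hv]
    · by_cases hva : v ∈ S.approx
      · convert ((hΨ v hva).comp_mul (c / S.subSteps v c)).iterate (S.subSteps v c) using 2 with t
        rw [step, dif_neg hv, if_pos hva, div_mul_eq_mul_div]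
      · convert (hasSmoothApprox_exactFlow hU (contDiffOn_rhs hf v) n).comp_mul c using 2 with t
        rw [step, dif_neg hv, if_neg hva]

variable {e : Finset (Fin N) → EuclideanSpace ℝ (Fin d) → EuclideanSpace ℝ (Fin d)} {p : ℕ}

theorem contDiffOn_accError (he : ∀ v ∈ S.active, ContDiffOn ℝ ∞ (e v) U) (v : Finset (Fin N))
    (c : ℝ) : ContDiffOn ℝ ∞ (S.accError e p v c) U := by
  induction hn : v.card using Nat.strong_induction_on generalizing v c with
  | _ k ih =>
    rw [accError]
    split_ifs with hv hva
    · refine contDiffOn_const.smul ((contDiffOn_const.smul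
        (he v (Finset.mem_union_left _ hv))).add ?_)
      rw [Finset.sum_fn]
      exact ContDiffOn.sum fun j _ => (ih _ (hn ▸ S.left_card_lt hv) (S.left v) _ rfl).add
        (ih _ (hn ▸ S.right_card_lt hv) (S.right v) _ rfl)
    · exact contDiffOn_const.smul (contDiffOn_const.smul (he v (Finset.mem_union_right _ hva)))
    · exact contDiffOn_const

theorem eventually_exactFlow_subSteps (hU : IsOpen U) (hf : ∀ m, ContDiffOn ℝ ∞ (f m) U)
    (hv : v ∈ S.nodes) (c : ℝ) {x : EuclideanSpace ℝ (Fin d)} (hx : x ∈ U) :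
    ∀ᶠ q in 𝓝 ((0 : ℝ), x),
      (exactFlow U (rhs f v) (c / S.subSteps v c * q.1))^[S.subSteps v c] q.2
        = exactFlow U (rhs f v) (c * q.1) q.2 := by
  filter_upwards [(tendsto_mul_fst (c / S.subSteps v c) x).eventually
    (eventually_exactFlow_iterate hU (contDiffOn_rhs hf v) hx (S.subSteps v c))] with q hq
  rw [hq, ← mul_assoc, S.subSteps_mul_div hv]

theorem hasDefect_step (hU : IsOpen U) (hf : ∀ m, ContDiffOn ℝ ∞ (f m) U)
    (he : ∀ v ∈ S.active, ContDiffOn ℝ ∞ (e v) U)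
    (hΨ : ∀ v ∈ S.approx, HasSmoothApprox U (p + 1) (S.Ψ v))
    (hd : ∀ v ∈ S.active, HasDefect U (p + 1) (S.nodeMethod U f v) (exactFlow U (rhs f v)) (e v))
    (hv : v ∈ S.nodes) (c : ℝ) :
    HasDefect U (p + 1) (S.step U f v c) (fun t => exactFlow U (rhs f v) (c * t))
      (S.accError e p v c) := by
  have hflow : ∀ v c, HasSmoothApprox U (p + 1) fun t => exactFlow U (rhs f v) (c * t) :=
    fun v c => (hasSmoothApprox_exactFlow hU (contDiffOn_rhs hf v) _).comp_mul c
  have hstep := S.hasSmoothApprox_step hU hf hΨ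
  have hacc := S.contDiffOn_accError (p := p) he
  induction hn : v.card using Nat.strong_induction_on generalizing v c with
  | _ k ih =>
    by_cases hvi : v ∈ S.innerNodes
    · obtain ⟨hv1, hv2⟩ := S.mem_innerNodes.1 hvi
      have hva : v ∈ S.active := Finset.mem_union_left _ hvi
      have h1 := fun c => ih _ (hn ▸ S.left_card_lt hvi) (S.left_mem v hv1 hv2) c rfl
      have h2 := fun c => ih _ (hn ▸ S.right_card_lt hvi) (S.right_mem v hv1 hv2) c rfl
      have h3 := HasDefect.altComp hU
        (A := fun j => S.step U f (S.left v) (S.a v j * c / S.subSteps v c))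
        (B := fun j => S.step U f (S.right v) (S.b v j * c / S.subSteps v c))
        (A' := fun j t => exactFlow U (rhs f (S.left v)) (S.a v j * c / S.subSteps v c * t))
        (B' := fun j t => exactFlow U (rhs f (S.right v)) (S.b v j * c / S.subSteps v c * t))
        (fun j => hstep _ _) (fun j => hstep _ _) (fun j => hflow _ _) (fun j => hflow _ _)
        (fun j => hacc _ _) (fun j => hacc _ _) (fun j => h1 _) (fun j => h2 _) (S.s v)
      have h4 := (hd v hva).comp_mul (c / S.subSteps v c)
      -- The two-split scheme of the node with the rescaled step is exactly the composition obtained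
      -- by replacing the children's steps by flows.
      have h5 : (fun t => S.nodeMethod U f v (c / S.subSteps v c * t)) = fun t =>
          altComp (fun j => exactFlow U (rhs f (S.left v)) (S.a v j * c / S.subSteps v c * t))
            (fun j => exactFlow U (rhs f (S.right v)) (S.b v j * c / S.subSteps v c * t))
            (S.s v) := by
        ext1 t
        rw [nodeMethod, if_pos hvi]
        simp only [mul_div_assoc, mul_assoc]
      rw [h5] at h4
      -- Errors of the children, then the node's own error, then multiplication by the number of
      -- sub-steps.
      have h6 := (h3.trans h4).iterate hU
        (HasSmoothApprox.altComp (fun j => hstep _ _) (fun j => hstep _ _) _) (hflow _ _)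
        (ContDiffOn.add (by
          rw [Finset.sum_fn]
          exact ContDiffOn.sum fun j _ => (hacc _ _).add (hacc _ _))
          (contDiffOn_const.smul (he v hva))) (S.subSteps v c)
      have h7 := h6.congr_right (Ψ' := fun t => exactFlow U (rhs f v) (c * t))
        fun x hx => S.eventually_exactFlow_subSteps hU hf hv c hx
      rw [accError, dif_pos hvi, add_comm (_ • e v)]
      convert h7 using 2 with t
      rw [step, dif_pos hvi]
    · by_cases hva : v ∈ S.approx
      · have hact : v ∈ S.active := Finset.mem_union_right _ hva
        have h4 := (hd v hact).comp_mul (c / S.subSteps v c)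
        rw [S.nodeMethod_of_mem_approx hva] at h4
        have h6 := h4.iterate hU ((hΨ v hva).comp_mul _) (hflow _ _)
          (contDiffOn_const.smul (he v hact)) (S.subSteps v c)
        have h7 := h6.congr_right (Ψ' := fun t => exactFlow U (rhs f v) (c * t))
          fun x hx => S.eventually_exactFlow_subSteps hU hf hv c hx
        rw [accError, dif_neg hvi, if_pos hva]
        convert h7 using 2 with t
        rw [step, dif_neg hvi, if_pos hva, div_mul_eq_mul_div]
      · rw [accError, dif_neg hvi, if_neg hva]
        convert HasDefect.refl (U := U) (k := p + 1) fun t => exactFlow U (rhs f v) (c * t)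
          using 2 with t
        rw [step, dif_neg hvi, if_neg hva]

end MultirateHSM

/-! ### Convergence from local error and stability -/

section Convergence

variable {d : ℕ} {U : Set (EuclideanSpace ℝ (Fin d))}
  {f e : EuclideanSpace ℝ (Fin d) → EuclideanSpace ℝ (Fin d)}
  {Φ : ℝ → EuclideanSpace ℝ (Fin d) → EuclideanSpace ℝ (Fin d)} {p : ℕ}

/-- Scheme and flow share one smooth approximant up to `O(h ^ (p + 1))`, and that approximant
expands differences by at most `1 + O(h)`. No regularity of the scheme itself is used. -/
theorem exists_local_stability (hU : IsOpen U) (hd : HasDefect U (p + 1) Φ (exactFlow U f) e)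
    (he : ContDiffOn ℝ ∞ e U) (hs : HasSmoothApprox U p Φ)
    {z₀ : EuclideanSpace ℝ (Fin d)} (hz₀ : z₀ ∈ U) :
    ∃ C, 0 ≤ C ∧ ∀ᶠ r : ℝ × EuclideanSpace ℝ (Fin d) × EuclideanSpace ℝ (Fin d) in 𝓝 (0, z₀, z₀),
      ‖Φ r.1 r.2.1 - exactFlow U f r.1 r.2.2‖
        ≤ (1 + C * |r.1|) * ‖r.2.1 - r.2.2‖ + C * |r.1| ^ (p + 1) := by
  obtain ⟨P, hP⟩ := hs
  obtain ⟨p1, -, p3⟩ := hP z₀ hz₀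
  have hP0 : ∀ᶠ y in 𝓝 z₀, P (0, y) = y := by
    filter_upwards [hU.mem_nhds hz₀] with y hy using (hP y hy).2.1
  have t1 : Tendsto (fun r : ℝ × EuclideanSpace ℝ (Fin d) × EuclideanSpace ℝ (Fin d) =>
      (r.1, r.2.1)) (𝓝 (0, z₀, z₀)) (𝓝 (0, z₀)) :=
    Continuous.tendsto' (by fun_prop) _ _ rfl
  have t2 : Tendsto (fun r : ℝ × EuclideanSpace ℝ (Fin d) × EuclideanSpace ℝ (Fin d) =>
      (r.1, r.2.2)) (𝓝 (0, z₀, z₀)) (𝓝 (0, z₀)) :=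
    Continuous.tendsto' (by fun_prop) _ _ rfl
  have hflow : (fun q : ℝ × EuclideanSpace ℝ (Fin d) => Φ q.1 q.2 - exactFlow U f q.1 q.2)
      =O[𝓝 ((0 : ℝ), z₀)] fun q => q.1 ^ (p + 1) := by
    have hc : ContinuousAt (fun q : ℝ × EuclideanSpace ℝ (Fin d) => e q.2) (0, z₀) :=
      ContinuousAt.comp (g := e) (f := Prod.snd) (x := ((0 : ℝ), z₀))
        (he.continuousOn.continuousAt (hU.mem_nhds hz₀)) continuousAt_snd
    have a := (fst_pow_isBigO (le_refl (p + 1)) z₀).smul (hc.isBigO_one ℝ)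
    have b := ((hd z₀ hz₀).trans (fst_pow_isBigO (Nat.le_succ (p + 1)) z₀)).add
      (by simpa using a)
    simpa using b
  have h1 : (fun r : ℝ × EuclideanSpace ℝ (Fin d) × EuclideanSpace ℝ (Fin d) =>
      (Φ r.1 r.2.1 - P (r.1, r.2.1)) - (exactFlow U f r.1 r.2.2 - P (r.1, r.2.2)))
      =O[𝓝 (0, z₀, z₀)] fun r => r.1 ^ (p + 1) := by
    have hP' : (fun q : ℝ × EuclideanSpace ℝ (Fin d) => exactFlow U f q.1 q.2 - P q)
        =O[𝓝 ((0 : ℝ), z₀)] fun q => q.1 ^ (p + 1) :=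
      (p3.sub hflow).congr_left fun q => by abel
    exact (p3.comp_tendsto t1).sub (hP'.comp_tendsto t2)
  obtain ⟨C₁, hC₁, b₁⟩ := h1.exists_nonneg
  obtain ⟨C₂, hC₂, b₂⟩ := (p1.sub_sub_isBigO hP0).exists_nonneg
  refine ⟨max C₁ C₂, le_max_of_le_left hC₁, ?_⟩
  filter_upwards [b₁.bound, b₂.bound] with r hr₁ hr₂
  simp only [norm_mul, norm_pow, Real.norm_eq_abs, abs_norm] at hr₁ hr₂
  have heq : Φ r.1 r.2.1 - exactFlow U f r.1 r.2.2
      = (r.2.1 - r.2.2) + (P (r.1, r.2.1) - P (r.1, r.2.2) - (r.2.1 - r.2.2))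
        + ((Φ r.1 r.2.1 - P (r.1, r.2.1)) - (exactFlow U f r.1 r.2.2 - P (r.1, r.2.2))) := by
    abel
  rw [heq]
  refine norm_add₃_le.trans ?_
  have e₁ := hr₁.trans (mul_le_mul_of_nonneg_right (le_max_left C₁ C₂) (by positivity))
  have e₂ := hr₂.trans (mul_le_mul_of_nonneg_right (le_max_right C₁ C₂) (by positivity))
  linarith

theorem exists_uniform_stability (hU : IsOpen U) (hd : HasDefect U (p + 1) Φ (exactFlow U f) e)
    (he : ContDiffOn ℝ ∞ e U) (hs : HasSmoothApprox U p Φ)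
    {s : Set (EuclideanSpace ℝ (Fin d))} (hsc : IsCompact s) (hsU : s ⊆ U) :
    ∃ C, 0 ≤ C ∧ ∃ r > 0, ∀ z ∈ s, ∀ x, ‖x - z‖ < r → ∀ h : ℝ, |h| < r →
      ‖Φ h x - exactFlow U f h z‖ ≤ (1 + C * |h|) * ‖x - z‖ + C * |h| ^ (p + 1) := by
  refine hsc.induction_on (p := fun s => ∃ C, 0 ≤ C ∧ ∃ r > 0, ∀ z ∈ s, ∀ x, ‖x - z‖ < r →
    ∀ h : ℝ, |h| < r →
      ‖Φ h x - exactFlow U f h z‖ ≤ (1 + C * |h|) * ‖x - z‖ + C * |h| ^ (p + 1))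
    ⟨0, le_rfl, 1, one_pos, by simp⟩ ?_ ?_ ?_
  · rintro s t hst ⟨C, hC, r, hr, h⟩
    exact ⟨C, hC, r, hr, fun z hz => h z (hst hz)⟩
  · rintro s t ⟨C, hC, r, hr, h⟩ ⟨C', hC', r', hr', h'⟩
    refine ⟨max C C', le_max_of_le_left hC, min r r', lt_min hr hr', ?_⟩
    rintro z (hz | hz) x hx τ hτ
    · refine (h z hz x (hx.trans_le (min_le_left _ _)) τ (hτ.trans_le (min_le_left _ _))).trans ?_
      gcongr <;> exact le_max_left _ _
    · refine (h' z hz x (hx.trans_le (min_le_right _ _)) τ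
        (hτ.trans_le (min_le_right _ _))).trans ?_
      gcongr <;> exact le_max_right _ _
  · intro z₀ hz₀
    obtain ⟨C, hC, h⟩ := exists_local_stability hU hd he hs (hsU hz₀)
    obtain ⟨δ, hδ, hball⟩ := Metric.eventually_nhds_iff_ball.1 h
    -- Half the radius is spent on `z`, half on the distance from `x` to `z`, so that both points
    -- stay in the ball of radius `δ`.
    refine ⟨Metric.ball z₀ (δ / 2), mem_nhdsWithin_of_mem_nhds
      (Metric.ball_mem_nhds _ (by positivity)), C, hC, δ / 2, by positivity, ?_⟩
    intro z hz x hx τ hτ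
    refine hball (τ, x, z) ?_
    rw [← ball_prod_same, ← ball_prod_same]
    rw [Metric.mem_ball] at hz
    refine ⟨?_, ?_, ?_⟩
    · simp only [Metric.mem_ball, Real.dist_eq, sub_zero]
      linarith
    · rw [← dist_eq_norm] at hx
      have := dist_triangle x z z₀
      rw [Metric.mem_ball]
      linarith
    · rw [Metric.mem_ball]
      linarith

theorem exactFlow_along_solution (hU : IsOpen U) (hf : ContDiffOn ℝ ∞ f U) {T : ℝ}
    {γ : ℝ → EuclideanSpace ℝ (Fin d)}
    (hγ : ∀ t ∈ Set.Icc 0 T, γ t ∈ U ∧ HasDerivWithinAt γ (f (γ t)) (Set.Icc 0 T) t)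
    {t h : ℝ} (ht : 0 ≤ t) (hh : 0 ≤ h) (hT : t + h ≤ T) :
    exactFlow U f h (γ t) = γ (t + h) := by
  refine exactFlow_eq (γ := fun τ => γ (t + τ)) hU hf ?_ (by simp)
  intro τ hτ
  rw [Set.uIcc_of_le hh] at hτ ⊢
  have hm : Set.MapsTo (fun τ => t + τ) (Set.Icc 0 h) (Set.Icc 0 T) := fun τ hτ =>
    ⟨by linarith [hτ.1], by linarith [hτ.2]⟩
  have h1 := hγ _ (hm hτ)
  refine ⟨h1.1, ?_⟩
  have h2 := HasDerivWithinAt.scomp (h := fun τ => t + τ) (g₁ := γ) τ h1.2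
    ((hasDerivWithinAt_id τ (Set.Icc 0 h)).const_add t) hm
  simpa [Function.comp_def] using h2

theorem convergesWithOrder_of_hasDefect (hU : IsOpen U) (hf : ContDiffOn ℝ ∞ f U) (hp : 1 ≤ p)
    (hd : HasDefect U (p + 1) Φ (exactFlow U f) e) (he : ContDiffOn ℝ ∞ e U)
    (hs : HasSmoothApprox U p Φ) : ConvergesWithOrder U Φ f p := by
  intro T γ hγ
  rcases lt_or_ge T 0 with hT | hT
  · refine ⟨1, one_pos, 1, one_pos, fun h hh _ n hn => ?_⟩
    have : 0 ≤ n * h := by positivity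
    linarith
  have hγc : ContinuousOn γ (Set.Icc 0 T) := fun t ht => (hγ t ht).2.continuousWithinAt
  obtain ⟨C, hC, r, hr, hstab⟩ := exists_uniform_stability hU hd he hs
    (isCompact_Icc.image_of_continuousOn hγc) (Set.image_subset_iff.2 fun t ht => (hγ t ht).1)
  set D := Real.exp (C * T) * T * C with hD
  have hD0 : 0 ≤ D := by positivity
  -- `D` bounds the accumulated error, and `D + 1` is positive even if `D = 0`. The bound `r / 2`
  -- makes `h` admissible for the stability estimate; the last one gives `D * h ^ p < r`, keeping
  -- the numerical solution in the tube.
  refine ⟨D + 1, by positivity, min 1 (min (r / 2) (r / (2 * (D + 1)))), by positivity, ?_⟩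
  intro h hh hle n hn
  have hh1 : h ≤ 1 := hle.trans (min_le_left _ _)
  have hh2 : h ≤ r / 2 := hle.trans ((min_le_right _ _).trans (min_le_left _ _))
  have hh3 : h ≤ r / (2 * (D + 1)) := hle.trans ((min_le_right _ _).trans (min_le_right _ _))
  have hpow : h ^ p ≤ h := by simpa using pow_le_pow_of_le_one hh.le hh1 hp
  have hsmall : D * h ^ p < r := by
    have h1 : h * (2 * (D + 1)) ≤ r := (le_div_iff₀ (by positivity)).1 hh3
    nlinarith [mul_le_mul_of_nonneg_left hpow hD0]
  have hbound : ∀ n : ℕ, n * h ≤ T →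
      (1 + C * h) ^ n * (n * (C * h ^ (p + 1))) ≤ D * h ^ p := by
    intro n hn
    have h1 : (1 + C * h) ^ n ≤ Real.exp (C * T) := by
      calc (1 + C * h) ^ n ≤ Real.exp (C * h) ^ n := by
            gcongr
            linarith [Real.add_one_le_exp (C * h)]
        _ = Real.exp (C * (n * h)) := by rw [← Real.exp_nat_mul]; ring_nf
        _ ≤ Real.exp (C * T) := by gcongr
    calc (1 + C * h) ^ n * (n * (C * h ^ (p + 1)))
        = (1 + C * h) ^ n * (n * h) * C * h ^ p := by ring
      _ ≤ Real.exp (C * T) * T * C * h ^ p := by gcongr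
  -- Discrete Gronwall: the induction must also show that the error stays below `r`, since stability
  -- holds only there; `hbound` and `hsmall` supply this.
  have herr : ∀ n : ℕ, n * h ≤ T →
      ‖(Φ h)^[n] (γ 0) - γ (n * h)‖ ≤ (1 + C * h) ^ n * (n * (C * h ^ (p + 1))) := by
    intro n
    induction n with
    | zero => simp
    | succ n ih =>
      intro hn
      push_cast at hn ⊢
      have hn' : n * h ≤ T := by linarith
      have ih' := ih hn'
      have hmem : n * h ∈ Set.Icc 0 T := ⟨by positivity, hn'⟩
      have hlt := (ih'.trans (hbound n hn')).trans_lt hsmall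
      have h1 := hstab (γ (n * h)) ⟨_, hmem, rfl⟩ _ hlt h (by rw [abs_of_pos hh]; linarith)
      rw [exactFlow_along_solution hU hf hγ hmem.1 hh.le (by linarith), abs_of_pos hh] at h1
      rw [Function.iterate_succ_apply', add_mul, one_mul]
      have hone : 1 ≤ (1 + C * h) ^ (n + 1) := one_le_pow₀ (by linarith [mul_nonneg hC hh.le])
      calc _ ≤ _ := h1
        _ ≤ (1 + C * h) * ((1 + C * h) ^ n * (n * (C * h ^ (p + 1))))
            + (1 + C * h) ^ (n + 1) * (C * h ^ (p + 1)) := by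
          exact add_le_add (mul_le_mul_of_nonneg_left ih' (by positivity))
            (le_mul_of_one_le_left (by positivity) hone)
        _ = (1 + C * h) ^ (n + 1) * ((n + 1) * (C * h ^ (p + 1))) := by ring
  calc _ ≤ _ := herr n hn
    _ ≤ D * h ^ p := hbound n hn
    _ ≤ (D + 1) * h ^ p := by gcongr; linarith

end Convergence

theorem mainTheorem2 {d N : ℕ} (hN : 2 ≤ N)
    (U : Set (EuclideanSpace ℝ (Fin d))) (hU : IsOpen U)
    (f : Fin N → EuclideanSpace ℝ (Fin d) → EuclideanSpace ℝ (Fin d))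
    (hf : ∀ m, ContDiffOn ℝ ∞ (f m) U)
    (S : MultirateHSM d N) (K : ℕ∞)
    (ord : Finset (Fin N) → ℕ)
    (err : Finset (Fin N) → EuclideanSpace ℝ (Fin d) → EuclideanSpace ℝ (Fin d))
    (hord : ∀ v ∈ S.active, 1 ≤ ord v)
    (hexp : ∀ v ∈ S.active,
      HasExpForm U K (S.nodeMethod U f v) (MultirateHSM.rhs f v) (ord v) (err v))
    (p : ℕ) (hp : IsLeast (ord '' (S.active : Set (Finset (Fin N)))) p) :
    HasExpForm U K (S.method U f) (fun x => ∑ m, f m x) p (S.leadingError ord err p) ∧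
      ConvergesWithOrder U (S.method U f) (fun x => ∑ m, f m x) p := by
  have hp1 : 1 ≤ p := by
    obtain ⟨v, hv, rfl⟩ := hp.1
    exact hord v hv
  have hple : ∀ v ∈ S.active, p ≤ ord v := fun v hv => hp.2 ⟨v, hv, rfl⟩
  have hrhs := MultirateHSM.contDiffOn_rhs hf
  have hfU : ContDiffOn ℝ ∞ (fun x => ∑ m, f m x) U := hrhs Finset.univ
  -- Only nodes of minimal order have a leading error at degree `p + 1`; the others enter with zero.
  set e : Finset (Fin N) → EuclideanSpace ℝ (Fin d) → EuclideanSpace ℝ (Fin d) :=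
    fun v => if ord v = p then err v else 0 with he_def
  have he : ∀ v ∈ S.active, ContDiffOn ℝ ∞ (e v) U := fun v hv => by
    simp only [he_def]
    split_ifs
    · exact (hexp v hv).contDiffOn
    · exact contDiffOn_const
  have hd : ∀ v ∈ S.active, HasDefect U (p + 1) (S.nodeMethod U f v)
      (exactFlow U (MultirateHSM.rhs f v)) (e v) := fun v hv => by
    have h := (hexp v hv).hasDefect hU (hrhs v) (hord v hv)
    simp only [he_def]
    split_ifs with hv'
    · rwa [hv'] at h
    · have := hple v hv
      exact h.of_lt hU (by omega) (hexp v hv).contDiffOn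
  have hΨ : ∀ n : ℕ, (n : ℕ∞) ≤ (p : ℕ∞) + 1 + K → ∀ v ∈ S.approx,
      HasSmoothApprox U n (S.Ψ v) := fun n hn v hv => by
    have hva : v ∈ S.active := Finset.mem_union_right _ hv
    rw [← S.nodeMethod_of_mem_approx (U := U) (f := f) hv]
    -- Since `p ≤ ord v`, each scheme is expandable at least as far as the overall method must be,
    -- so the same `K` survives.
    refine (hexp v hva).hasSmoothApprox hU (hn.trans ?_)
    gcongr
    exact hple v hva
  have hp1K : ((p + 1 : ℕ) : ℕ∞) ≤ (p : ℕ∞) + 1 + K := by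
    push_cast
    exact le_self_add
  have hs : ∀ n : ℕ, (n : ℕ∞) ≤ (p : ℕ∞) + 1 + K → HasSmoothApprox U n (S.method U f) :=
    fun n hn => S.hasSmoothApprox_step hU hf (hΨ n hn) Finset.univ 1
  have herr : S.leadingError ord err p = S.accError e p Finset.univ 1 := by
    rw [S.accError_univ e hp1]
    ext1 x
    rw [MultirateHSM.leadingError, Finset.sum_filter, Finset.sum_apply]
    refine Finset.sum_congr rfl fun v _ => ?_
    simp only [he_def]
    split_ifs
    · rfl
    · simp
  have hdef : HasDefect U (p + 1) (S.method U f) (exactFlow U fun x => ∑ m, f m x)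
      (S.leadingError ord err p) := by
    have h := S.hasDefect_step hU hf he (hΨ _ hp1K) hd S.root_mem 1
    simp only [one_mul] at h
    rw [herr]
    exact h
  have hsm : ContDiffOn ℝ ∞ (S.leadingError ord err p) U :=
    herr ▸ S.contDiffOn_accError he Finset.univ 1
  exact ⟨hasExpForm_of_hasDefect hU hfU hp1 hdef hs,
    convergesWithOrder_of_hasDefect hU hfU hp1 hdef hsm ((hs _ hp1K).of_le (Nat.le_succ p))⟩
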